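/- Fix $a>2$ and $\sigma>0$. For each $p$ let $X\in\mathbb{R}^{n\times p}$ (with $n=n_p$ and $X$ depending on $p$) be an orthogonal design, $X^TX=I_p$, with columns $X_1,\dots,X_p$, and let $y=X\beta^*+\varepsilon$ with $\varepsilon\sim N(0,\sigma^2 I_n)$ and $\beta^*=0$ (global null model). For $\lambda\ge 0$ let $p_\lambda$ be the SCAD penalty with parameter $a$, that is, the even function on $\mathbb{R}$ with $p_\lambda(0)=0$ and, for $t>0$, $p_\lambda'(t)=\lambda$ if $t\le\lambda$ and $p_\lambda'(t)=(a\lambda-t)_+/(a-1)$ if $t>\lambda$. For $A\subseteq\{1,\dots,p\}$ let $\tilde\beta_A(\lambda)$ be the minimizer of $\frac12\|y-X\beta\|_2^2+\sum_j p_\lambda(\beta_j)$ among the $\beta\in\mathbb{R}^p$ with $\beta_j=0$ for $j\notin A$, and let $\hat\beta(\lambda)=\tilde\beta_{\{1,\dots,p\}}(\lambda)$. Let $\lambda_1>\lambda_2>\cdots$ be the knots of the path, i.e. the values $\lambda>0$ at which the support of $\hat\beta(\lambda)$ changes, with $\lambda_k=0$ once the knots are exhausted. With $A$ the support of $\hat\beta(\lambda)$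 for $\lambda$ just above $\lambda_k$, the SCAD covariance statistic is $$T_k^{\mathrm{scad}}=\frac{\langle y,X\hat\beta(\lambda_{k+1})\rangle-\langle y,X\tilde\beta_A(\lambda_{k+1})\rangle}{\sigma^2}.$$ Let $V_1\ge V_2\ge\dots\ge V_p$ be the order statistics of $|X_1^Ty|,\dots,|X_p^Ty|$. (i) For $1\le k<p$, almost surely, $$T_k^{\mathrm{scad}}=\begin{cases} V_k(V_k-V_{k+1})/\sigma^2, & V_k\le 2V_{k+1},\\[2pt] \frac{a-1}{a-2}V_k\bigl(V_k-\frac{a}{a-1}V_{k+1}\bigr)/\sigma^2, & 2V_{k+1}<V_k<aV_{k+1},\\[2pt] V_k^2/\sigma^2, & V_k\ge aV_{k+1}.\end{cases}$$ (ii) For every fixed $k\ge 1$, as $p\to\infty$, $$(T_1^{\mathrm{scad}},\dots,T_k^{\mathrm{scad}})\ \xrightarrow{d}\ (\mathrm{Exp}(1),\mathrm{Exp}(1/2),\dots,\mathrm{Exp}(1/k)),$$ where the limit has independent components and $\mathrm{Exp}(1/i)$ denotes the exponential distribution with mean $1/i$ (rate $i$). -/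

import Mathlib

open MeasureTheory ProbabilityTheory Filter Topology Matrix

noncomputable section

/-- The SCAD penalty `p_lam(u)` with parameter `a`: the even function of `u` with `p_lam(0) = 0`
whose derivative at `t > 0` is `lam` for `t ≤ lam` and `max (a * lam - t) 0 / (a - 1)` for
`t > lam`. -/
def scadPenalty (a lam u : ℝ) : ℝ :=
  ∫ t in (0 : ℝ)..|u|, if t ≤ lam then lam else max (a * lam - t) 0 / (a - 1)

/-- The penalized least-squares criterion
`(1/2) ‖y - X b‖² + ∑ j, pen lam (b j)`, with the Euclidean norm. -/
def penObjective {n p : ℕ} (pen : ℝ → ℝ → ℝ) (X : Matrix (Fin n) (Fin p) ℝ)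
    (y : Fin n → ℝ) (lam : ℝ) (b : Fin p → ℝ) : ℝ :=
  ((1 / 2) * ∑ i, (y i - (X *ᵥ b) i) ^ 2) + (∑ j, pen lam (b j))

/-- `b` is a penalized least-squares estimate when only the variables in `A` may be used: its
coefficients outside `A` are zero, and it minimizes the criterion among all such vectors. -/
def IsPenLS {n p : ℕ} (pen : ℝ → ℝ → ℝ) (X : Matrix (Fin n) (Fin p) ℝ)
    (y : Fin n → ℝ) (A : Set (Fin p)) (lam : ℝ) (b : Fin p → ℝ) : Prop :=
  (∀ j, j ∉ A → b j = 0) ∧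
    ∀ c : Fin p → ℝ, (∀ j, j ∉ A → c j = 0) →
      penObjective pen X y lam b ≤ penObjective pen X y lam c

/-- The penalized least-squares estimate over the variables in `A` (a chosen minimizer; for an
orthogonal design and the SCAD penalty with `a > 2` and `lam ≥ 0` the minimizer exists and is
unique). -/
def penLS {n p : ℕ} (pen : ℝ → ℝ → ℝ) (X : Matrix (Fin n) (Fin p) ℝ)
    (y : Fin n → ℝ) (A : Set (Fin p)) (lam : ℝ) : Fin p → ℝ :=
  Classical.epsilon (IsPenLS pen X y A lam)

/-- The active set at `lam`: the support of the estimate that uses all variables. -/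
def activeSet {n p : ℕ} (pen : ℝ → ℝ → ℝ) (X : Matrix (Fin n) (Fin p) ℝ)
    (y : Fin n → ℝ) (lam : ℝ) : Set (Fin p) :=
  {j | penLS pen X y Set.univ lam j ≠ 0}

/-- The set of knots of the path: the values `lam > 0` at which the active set changes. -/
def knotSet {n p : ℕ} (pen : ℝ → ℝ → ℝ) (X : Matrix (Fin n) (Fin p) ℝ)
    (y : Fin n → ℝ) : Set ℝ :=
  {lam | 0 < lam ∧ ¬ ∀ᶠ l in 𝓝 lam, activeSet pen X y l = activeSet pen X y lam}

/-- The knots in decreasing order, `knot 1 > knot 2 > ...`; when they are exhausted the value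
is `sSup ∅ = 0`, the end of the path. The index `0` is not used. -/
def knot {n p : ℕ} (pen : ℝ → ℝ → ℝ) (X : Matrix (Fin n) (Fin p) ℝ)
    (y : Fin n → ℝ) : ℕ → ℝ
  | 0 => 0
  | 1 => sSup (knotSet pen X y)
  | k + 2 => sSup (knotSet pen X y ∩ Set.Iio (knot pen X y (k + 1)))

/-- The active set just before the `k`-th knot, the path being followed from large values of
the tuning parameter to small ones. -/
def activeBefore {n p : ℕ} (pen : ℝ → ℝ → ℝ) (X : Matrix (Fin n) (Fin p) ℝ)
    (y : Fin n → ℝ) (k : ℕ) : Set (Fin p) :=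
  {j | ∀ᶠ l in 𝓝[>] (knot pen X y k), j ∈ activeSet pen X y l}

/-- The covariance test statistic at the `k`-th knot (`k = 1, 2, ...`),
`T_k = (⟨y, X β̂(λ_{k+1})⟩ - ⟨y, X_A β̃_A(λ_{k+1})⟩) / σ²`, where `A` is the active set just
before `λ_k`, and `β̂` and `β̃_A` are the penalized estimates with all variables and with the
variables in `A` only. -/
def covStat {n p : ℕ} (pen : ℝ → ℝ → ℝ) (σ : ℝ) (X : Matrix (Fin n) (Fin p) ℝ)
    (y : Fin n → ℝ) (k : ℕ) : ℝ :=
  (y ⬝ᵥ (X *ᵥ penLS pen X y Set.univ (knot pen X y (k + 1)))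
    - y ⬝ᵥ (X *ᵥ penLS pen X y (activeBefore pen X y k) (knot pen X y (k + 1)))) / σ ^ 2

/-- The `k`-th largest entry of `v` (`k = 1, ..., p`, counted with multiplicity): the largest `t`
such that at least `k` entries of `v` are at least `t`. -/
def kthLargest {p : ℕ} (v : Fin p → ℝ) (k : ℕ) : ℝ :=
  sSup {t : ℝ | k ≤ {j : Fin p | t ≤ v j}.ncard}

/-- The order statistics `V_1 ≥ V_2 ≥ ... ≥ V_p` of `|X_jᵀ y|`, `j = 1, ..., p`. -/
def absCorrOrderStat {n p : ℕ} (X : Matrix (Fin n) (Fin p) ℝ) (y : Fin n → ℝ) (k : ℕ) : ℝ :=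
  kthLargest (fun j => |(Xᵀ *ᵥ y) j|) k

/-- The piecewise form of the SCAD statistic, as a function of `V = V_k` and `W = V_{k+1}`. -/
def scadFormula (a σ V W : ℝ) : ℝ :=
  if V ≤ 2 * W then V * (V - W) / σ ^ 2
  else if V < a * W then (a - 1) / (a - 2) * V * (V - a / (a - 1) * W) / σ ^ 2
  else V ^ 2 / σ ^ 2

/-- The Gaussian linear model `y = X β + ε`, with `ε` having independent `N(0, σ²)` entries. -/
def GaussianLinearModel {n p : ℕ} {Ω : Type*} [MeasurableSpace Ω]
    (X : Matrix (Fin n) (Fin p) ℝ) (β : Fin p → ℝ) (σ : ℝ) (y : Ω → Fin n → ℝ)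
    (P : Measure Ω) : Prop :=
  HasLaw (fun ω => y ω - X *ᵥ β)
    (Measure.pi fun _ : Fin n => gaussianReal 0 (Real.toNNReal (σ ^ 2))) P

/-- The joint law of `k` independent exponential variables with means `1, 1/2, ..., 1/k`
(that is, with rates `1, 2, ..., k`). -/
def expLimitLaw (k : ℕ) : Measure (Fin k → ℝ) :=
  Measure.pi fun i : Fin k => expMeasure (((i : ℕ) : ℝ) + 1)

instance expLimitLaw_isProbabilityMeasure (k : ℕ) : IsProbabilityMeasure (expLimitLaw k) := by
  have : ∀ i : Fin k, IsProbabilityMeasure (expMeasure (((i : ℕ) : ℝ) + 1)) :=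
    fun i => isProbabilityMeasure_expMeasure (by positivity)
  unfold expLimitLaw
  infer_instance

end

/-! Write `z = Xᵀ y`. Orthogonality splits the criterion into scalar problems `(b - z_j)² / 2 +
p_λ(b)`. On the half-line the penalty's derivative decreases at rate at most `1 / (a - 1)`, which
for `a > 2` is less than the curvature `1` of the square. So each scalar problem has a unique
minimizer, `sign z_j * scadThreshold a λ |z_j|`, and it is nonzero exactly when `λ < |z_j|`. If the
`|z_j|` are distinct and nonzero, as holds almost surely, the knots are therefore the order
statistics `V_k`. In `T_k` the coordinates with `|z_j| > V_k` cancel and those with `|z_j| ≤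
V_{k+1}` vanish, which leaves `V_k * scadThreshold a V_{k+1} V_k / σ²`: the three-case formula
(`covStat_scad_eq`).

For the limit, let `H(x) = -log P(|Z| > x)` be the half-normal hazard. Under the null model the
scores `H(|z_j| / σ)` are independent standard exponentials, so by Rényi's representation
(`map_spacings_pi_expMeasure`) the first `k` gaps of their order statistics have exactly the limit
law as soon as `p ≥ k`. Mills-ratio monotonicity gives `(v² - w²) / 2 ≤ H(v) - H(w) ≤ (v + 1/w)(v -
w)`, so `v (v - w)` is close to the gap when `w` is large and the gap is bounded. As `p` grows, `w =
V_{i+1} / σ` tends to infinity in probability while the gaps stay tight. Hence only the case `V ≤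
2W` matters, the difference between statistics and gaps vanishes in probability, and Slutsky's lemma
concludes. -/

open scoped ENNReal NNReal

/-! ### The scalar SCAD problem. -/

/-- The derivative of the SCAD penalty. -/
noncomputable def scadDeriv (a lam t : ℝ) : ℝ :=
  if t ≤ lam then lam else max (a * lam - t) 0 / (a - 1)

/-- The minimizer over `u ≥ 0` of `(u - z) ^ 2 / 2 + scadPenalty a lam u`, for `z ≥ 0`. -/
noncomputable def scadThreshold (a lam z : ℝ) : ℝ :=
  if z ≤ 2 * lam then max (z - lam) 0
  else if z < a * lam then ((a - 1) * z - a * lam) / (a - 2) else z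

/-- Weak convexity of the penalty: adding `u² / (2 (a - 1))` makes it convex on the half-line. -/
theorem monotone_scadDeriv_add {a : ℝ} (ha : 2 < a) (lam : ℝ) :
    Monotone fun t => scadDeriv a lam t + t / (a - 1) := by
  have h1 : 0 < a - 1 := by linarith
  intro s t hst
  have key : ∀ u, lam ≤ u → max (a * lam - u) 0 / (a - 1) + u / (a - 1) =
      max (a * lam) u / (a - 1) := by
    intro u _
    rw [← add_div, ← max_add_add_right]
    simp
  simp only [scadDeriv]
  split_ifs with h h' h'
  · gcongr
  · rw [key t (by linarith), add_comm, ← le_sub_iff_add_le, div_le_iff₀ h1, sub_mul,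
      div_mul_cancel₀ _ h1.ne']
    nlinarith [le_max_left (a * lam) t]
  · linarith
  · rw [key t (by linarith), key s (by linarith)]
    gcongr

theorem intervalIntegrable_scadDeriv {a : ℝ} (ha : 2 < a) (lam r u : ℝ) :
    IntervalIntegrable (scadDeriv a lam) volume r u := by
  have h1 := (monotone_scadDeriv_add ha lam).intervalIntegrable (μ := volume) (a := r) (b := u)
  have h2 : IntervalIntegrable (fun t : ℝ => t / (a - 1)) volume r u :=
    (by fun_prop : Continuous fun t : ℝ => t / (a - 1)).intervalIntegrable _ _
  simpa using h1.sub h2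

theorem mul_sub_le_intervalIntegral_of_monotone {f : ℝ → ℝ} (hf : Monotone f) (r u : ℝ) :
    f r * (u - r) ≤ ∫ t in r..u, f t := by
  rcases le_total r u with h | h
  · have := intervalIntegral.integral_mono_on h (by simp) hf.intervalIntegrable
      (f := fun _ => f r) (g := f) (μ := volume) (fun x hx => hf hx.1)
    simp only [intervalIntegral.integral_const, smul_eq_mul] at this
    linarith
  · have := intervalIntegral.integral_mono_on h hf.intervalIntegrable (by simp)
      (f := f) (g := fun _ => f r) (μ := volume) (fun x hx => hf hx.2)
    simp only [intervalIntegral.integral_const, smul_eq_mul] at this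
    rw [intervalIntegral.integral_symm]
    linarith

/-- The subgradient inequality at `r` for the convexified penalty, with the added quadratic moved
back to the other side. -/
theorem scadPenalty_sub_ge {a : ℝ} (ha : 2 < a) (lam : ℝ) {r u : ℝ} (hr : 0 ≤ r)
    (hu : 0 ≤ u) :
    scadDeriv a lam r * (u - r) - (u - r) ^ 2 / (2 * (a - 1)) ≤
      scadPenalty a lam u - scadPenalty a lam r := by
  have h1 : a - 1 ≠ 0 := by linarith
  have hsub : scadPenalty a lam u - scadPenalty a lam r = ∫ t in r..u, scadDeriv a lam t := by
    rw [scadPenalty, scadPenalty, abs_of_nonneg hr, abs_of_nonneg hu]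
    exact intervalIntegral.integral_interval_sub_left (intervalIntegrable_scadDeriv ha lam 0 u)
      (intervalIntegrable_scadDeriv ha lam 0 r)
  have h2 := mul_sub_le_intervalIntegral_of_monotone (monotone_scadDeriv_add ha lam) r u
  rw [intervalIntegral.integral_add (intervalIntegrable_scadDeriv ha lam r u)
    ((by fun_prop : Continuous fun t : ℝ => t / (a - 1)).intervalIntegrable _ _),
    intervalIntegral.integral_div, integral_id] at h2
  rw [hsub]
  have h3 : (u ^ 2 - r ^ 2) / 2 / (a - 1) - r / (a - 1) * (u - r) =
      (u - r) ^ 2 / (2 * (a - 1)) := by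
    field_simp
    ring
  linarith

theorem scadThreshold_nonneg {a lam z : ℝ} (ha : 2 < a) (hlam : 0 ≤ lam) :
    0 ≤ scadThreshold a lam z := by
  unfold scadThreshold
  split_ifs with h1 h2
  · exact le_max_right _ _
  · apply div_nonneg _ (by linarith)
    nlinarith
  · linarith

theorem scadThreshold_pos_iff {a lam z : ℝ} (ha : 2 < a) (hlam : 0 ≤ lam) :
    0 < scadThreshold a lam z ↔ lam < z := by
  unfold scadThreshold
  split_ifs with h1 h2
  · simp
  · refine ⟨fun _ => by linarith, fun _ => div_pos ?_ (by linarith)⟩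
    nlinarith
  · constructor <;> intro <;> linarith

/-- First-order condition for minimizing over `[0, ∞)`: the derivative vanishes at an interior point
and is nonnegative at the endpoint `0`. -/
theorem scadThreshold_stationary {a lam z u : ℝ} (ha : 2 < a) (hlam : 0 ≤ lam) (hu : 0 ≤ u) :
    0 ≤ (scadDeriv a lam (scadThreshold a lam z) + scadThreshold a lam z - z) *
      (u - scadThreshold a lam z) := by
  have h2 : 0 < a - 2 := by linarith
  have h1 : 0 < a - 1 := by linarith
  unfold scadThreshold
  split_ifs with h h'
  · rcases le_total z lam with hz | hz
    · rw [max_eq_right (by linarith), scadDeriv, if_pos hlam]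
      exact mul_nonneg (by linarith) (by linarith)
    · rw [max_eq_left (by linarith), scadDeriv, if_pos (by linarith)]
      simp
  · have hgt : ¬ ((a - 1) * z - a * lam) / (a - 2) ≤ lam := by
      rw [div_le_iff₀ h2]
      nlinarith
    have hle : ((a - 1) * z - a * lam) / (a - 2) ≤ a * lam := by
      rw [div_le_iff₀ h2]
      nlinarith
    rw [scadDeriv, if_neg hgt, max_eq_left (by linarith)]
    apply le_of_eq
    have : (a * lam - ((a - 1) * z - a * lam) / (a - 2)) / (a - 1) +
      ((a - 1) * z - a * lam) / (a - 2) - z = 0 := by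
      field_simp
      ring
    rw [this, zero_mul]
  · have hz : ¬ z ≤ lam := by linarith
    rw [scadDeriv, if_neg hz, max_eq_right (by linarith)]
    simp

/-- Since `(b - z)² / 2 = (|b| - |z|)² / 2 + (|b z| - b z)`, the problem reduces to the half-line.
There stationarity and weak convexity leave the modulus `1/2 - 1/(2(a-1)) = (a-2)/(2(a-1)) > 0`. The
two surplus terms give uniqueness: one fixes `|b|`, the other the sign of `b`. -/
theorem scad_scalar_quadratic_growth {a lam z b : ℝ} (ha : 2 < a) (hlam : 0 ≤ lam) :
    (z.sign * scadThreshold a lam |z| - z) ^ 2 / 2 +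
        scadPenalty a lam (z.sign * scadThreshold a lam |z|) +
        (a - 2) / (2 * (a - 1)) * (|b| - scadThreshold a lam |z|) ^ 2 + (|b * z| - b * z) ≤
      (b - z) ^ 2 / 2 + scadPenalty a lam b := by
  have h1 : a - 1 ≠ 0 := by linarith
  set r := scadThreshold a lam |z| with hr
  have hr0 : 0 ≤ r := scadThreshold_nonneg ha hlam
  have hA := scadPenalty_sub_ge ha lam hr0 (abs_nonneg b)
  have hB := scadThreshold_stationary (z := |z|) ha hlam (abs_nonneg b)
  rw [← hr] at hB
  have habs : ∀ c, scadPenalty a lam |c| = scadPenalty a lam c := by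
    intro c; simp [scadPenalty]
  have hpen : scadPenalty a lam (z.sign * r) = scadPenalty a lam r ∧
      (z.sign * r - z) ^ 2 = (r - |z|) ^ 2 := by
    rcases lt_trichotomy z 0 with h | h | h
    · rw [Real.sign_of_neg h, abs_of_neg h, ← habs (-1 * r)]
      simp only [neg_mul, one_mul, abs_neg, habs]
      refine ⟨trivial, by ring⟩
    · have : r = 0 := by
        rw [hr, h, abs_zero]
        by_contra hne
        have := (scadThreshold_pos_iff (z := 0) ha hlam).1
          (lt_of_le_of_ne (scadThreshold_nonneg ha hlam) (Ne.symm hne))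
        linarith
      rw [this, h]; simp
    · rw [Real.sign_of_pos h, abs_of_pos h, one_mul]
      exact ⟨rfl, rfl⟩
  rw [hpen.1, hpen.2, abs_mul]
  rw [habs] at hA
  have h3 : (|b| - r) ^ 2 / 2 - (|b| - r) ^ 2 / (2 * (a - 1)) =
      (a - 2) / (2 * (a - 1)) * (|b| - r) ^ 2 := by
    field_simp
    ring
  have hb := sq_abs b
  have hz := sq_abs z
  nlinarith

theorem eq_of_abs_eq_of_mul_nonneg {b z r : ℝ} (hb : |b| = r) (hz : r ≠ 0 → z ≠ 0)
    (hbz : 0 ≤ b * z) : b = z.sign * r := by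
  rcases lt_trichotomy z 0 with h | h | h
  · rw [Real.sign_of_neg h, ← hb, abs_of_nonpos (by nlinarith)]; ring
  · have : r = 0 := by by_contra hne; exact hz hne h
    rw [this] at hb ⊢
    simpa using hb
  · rw [Real.sign_of_pos h, ← hb, abs_of_nonneg (by nlinarith)]; ring

theorem scad_scalar_eq_of_le {a lam z b : ℝ} (ha : 2 < a) (hlam : 0 ≤ lam)
    (h : (b - z) ^ 2 / 2 + scadPenalty a lam b ≤
      (z.sign * scadThreshold a lam |z| - z) ^ 2 / 2 +
        scadPenalty a lam (z.sign * scadThreshold a lam |z|)) :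
    b = z.sign * scadThreshold a lam |z| := by
  have h0 := scad_scalar_quadratic_growth (z := z) (b := b) ha hlam
  have hc : 0 < (a - 2) / (2 * (a - 1)) := div_pos (by linarith) (by linarith)
  have h1 : 0 ≤ |b * z| - b * z := by linarith [le_abs_self (b * z)]
  have h2 := mul_nonneg hc.le (sq_nonneg (|b| - scadThreshold a lam |z|))
  have h3 : (a - 2) / (2 * (a - 1)) * (|b| - scadThreshold a lam |z|) ^ 2 = 0 := by linarith
  have h4 : |b * z| = b * z := by linarith
  rw [mul_eq_zero, or_iff_right hc.ne', sq_eq_zero_iff, sub_eq_zero] at h3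
  refine eq_of_abs_eq_of_mul_nonneg h3 (fun hr hz => ?_) (h4 ▸ abs_nonneg _)
  have := (scadThreshold_pos_iff (z := |z|) ha hlam).1
    (lt_of_le_of_ne (scadThreshold_nonneg ha hlam) (Ne.symm hr))
  rw [hz, abs_zero] at this
  linarith

/-! ### Estimates, active sets and knots for an orthogonal design. -/

/-- The SCAD estimate over the variables in `A` for an orthogonal design, in terms of
`z = Xᵀ y`. -/
noncomputable def scadEstimate {p : ℕ} (a : ℝ) (z : Fin p → ℝ) (A : Set (Fin p)) (lam : ℝ) :
    Fin p → ℝ :=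
  open Classical in fun j => if j ∈ A then (z j).sign * scadThreshold a lam |z j| else 0

section Design

variable {n p : ℕ} {X : Matrix (Fin n) (Fin p) ℝ} {a : ℝ}

theorem penObjective_orthogonal (pen : ℝ → ℝ → ℝ) (hX : Xᵀ * X = 1) (y : Fin n → ℝ) (lam : ℝ)
    (b : Fin p → ℝ) :
    penObjective pen X y lam b = (y ⬝ᵥ y - (Xᵀ *ᵥ y) ⬝ᵥ (Xᵀ *ᵥ y)) / 2 +
      ∑ j, ((b j - (Xᵀ *ᵥ y) j) ^ 2 / 2 + pen lam (b j)) := by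
  have h1 : ∑ i, (y i - (X *ᵥ b) i) ^ 2 = (y - X *ᵥ b) ⬝ᵥ (y - X *ᵥ b) := by
    simp [dotProduct, sq]
  have h2 : (X *ᵥ b) ⬝ᵥ (X *ᵥ b) = b ⬝ᵥ b := by
    rw [dotProduct_mulVec, vecMul_mulVec, hX, ← mulVec_transpose, transpose_one, one_mulVec]
  have h3 : y ⬝ᵥ (X *ᵥ b) = (Xᵀ *ᵥ y) ⬝ᵥ b := by
    rw [dotProduct_mulVec, mulVec_transpose]
  have h4 : ∑ j, (b j - (Xᵀ *ᵥ y) j) ^ 2 = (b - Xᵀ *ᵥ y) ⬝ᵥ (b - Xᵀ *ᵥ y) := by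
    simp [dotProduct, sq]
  rw [penObjective, h1, Finset.sum_add_distrib, ← Finset.sum_div, h4]
  simp only [sub_dotProduct, dotProduct_sub]
  rw [dotProduct_comm (X *ᵥ b) y, h2, h3, dotProduct_comm b (Xᵀ *ᵥ y)]
  ring

theorem isPenLS_scad_iff (ha : 2 < a) (hX : Xᵀ * X = 1) (y : Fin n → ℝ) (A : Set (Fin p))
    {lam : ℝ} (hlam : 0 ≤ lam) (b : Fin p → ℝ) :
    IsPenLS (scadPenalty a) X y A lam b ↔ b = scadEstimate a (Xᵀ *ᵥ y) A lam := by
  classical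
  have hA : ∀ j, j ∉ A → scadEstimate a (Xᵀ *ᵥ y) A lam j = 0 := by
    intro j hj; simp [scadEstimate, hj]
  have hterm : ∀ c : Fin p → ℝ, (∀ j, j ∉ A → c j = 0) → ∀ j,
      (scadEstimate a (Xᵀ *ᵥ y) A lam j - (Xᵀ *ᵥ y) j) ^ 2 / 2 +
        scadPenalty a lam (scadEstimate a (Xᵀ *ᵥ y) A lam j) ≤
      (c j - (Xᵀ *ᵥ y) j) ^ 2 / 2 + scadPenalty a lam (c j) := by
    intro c hc j
    by_cases hj : j ∈ A
    · simp only [scadEstimate, hj, if_true]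
      have h0 := scad_scalar_quadratic_growth (z := (Xᵀ *ᵥ y) j) (b := c j) ha hlam
      have hc : 0 < (a - 2) / (2 * (a - 1)) := div_pos (by linarith) (by linarith)
      have h2 := mul_nonneg hc.le (sq_nonneg (|c j| - scadThreshold a lam |(Xᵀ *ᵥ y) j|))
      linarith [le_abs_self (c j * (Xᵀ *ᵥ y) j)]
    · rw [hA j hj, hc j hj]
  have hmin : IsPenLS (scadPenalty a) X y A lam (scadEstimate a (Xᵀ *ᵥ y) A lam) := by
    refine ⟨hA, fun c hc => ?_⟩
    rw [penObjective_orthogonal _ hX, penObjective_orthogonal _ hX]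
    exact (add_le_add_iff_left _).2 (Finset.sum_le_sum fun j _ => hterm c hc j)
  refine ⟨fun hb => ?_, fun h => h ▸ hmin⟩
  have hle := hb.2 _ hA
  rw [penObjective_orthogonal _ hX, penObjective_orthogonal _ hX, add_le_add_iff_left] at hle
  have heq := (Finset.sum_eq_sum_iff_of_le (fun j _ => hterm b hb.1 j)).1
    (le_antisymm (Finset.sum_le_sum fun j _ => hterm b hb.1 j) hle)
  ext j
  by_cases hj : j ∈ A
  · have := heq j (Finset.mem_univ j)
    simp only [scadEstimate, hj, if_true] at this ⊢
    exact scad_scalar_eq_of_le ha hlam this.ge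
  · rw [hA j hj, hb.1 j hj]

theorem penLS_scad (ha : 2 < a) (hX : Xᵀ * X = 1) (y : Fin n → ℝ) (A : Set (Fin p))
    {lam : ℝ} (hlam : 0 ≤ lam) :
    penLS (scadPenalty a) X y A lam = scadEstimate a (Xᵀ *ᵥ y) A lam :=
  (isPenLS_scad_iff ha hX y A hlam _).1
    (Classical.epsilon_spec ⟨_, (isPenLS_scad_iff ha hX y A hlam _).2 rfl⟩)

theorem mem_activeSet_scad (ha : 2 < a) (hX : Xᵀ * X = 1) (y : Fin n → ℝ) {lam : ℝ}
    (hlam : 0 ≤ lam) (j : Fin p) :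
    j ∈ activeSet (scadPenalty a) X y lam ↔ lam < |(Xᵀ *ᵥ y) j| := by
  rw [activeSet, Set.mem_ofPred_eq, penLS_scad ha hX y _ hlam]
  simp only [scadEstimate, Set.mem_univ, if_true]
  rw [← scadThreshold_pos_iff ha hlam, (scadThreshold_nonneg ha hlam).lt_iff_ne, mul_ne_zero_iff,
    ne_comm (a := (0 : ℝ)), and_iff_right_iff_imp, Ne, Ne,
    Real.sign_eq_zero_iff]
  intro h hz
  have := (scadThreshold_pos_iff ha hlam).1 ((scadThreshold_nonneg ha hlam).lt_of_ne (Ne.symm h))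
  rw [hz, abs_zero] at this
  linarith

theorem knotSet_scad (ha : 2 < a) (hX : Xᵀ * X = 1) (y : Fin n → ℝ) :
    knotSet (scadPenalty a) X y = {t | 0 < t} ∩ Set.range fun j => |(Xᵀ *ᵥ y) j| := by
  ext lam
  simp only [knotSet, Set.mem_ofPred_eq, Set.mem_inter_iff, Set.mem_range]
  refine and_congr_right fun hlam => ?_
  constructor
  · intro h
    by_contra hne
    push Not at hne
    apply h
    have h1 : ∀ j, ∀ᶠ l in 𝓝 lam, (l < |(Xᵀ *ᵥ y) j| ↔ lam < |(Xᵀ *ᵥ y) j|) := by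
      intro j
      rcases (hne j).lt_or_gt with hj | hj
      · filter_upwards [lt_mem_nhds hj] with l hl
        simp [hj.le, not_lt.2 hl.le]
      · filter_upwards [gt_mem_nhds hj] with l hl
        simp [hj, hl]
    filter_upwards [eventually_all.2 h1, lt_mem_nhds hlam] with l hl hl0
    ext j
    rw [mem_activeSet_scad ha hX y hlam.le, mem_activeSet_scad ha hX y hl0.le, hl j]
  · rintro ⟨j, hj⟩ h
    -- The change is seen from the left: variable `j` is active for `l < |z_j|` but not at `|z_j|`
    -- itself.
    obtain ⟨l, ⟨h1, h2⟩, h3⟩ := ((((h.and (lt_mem_nhds hlam)).filter_mono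
      (nhdsWithin_le_nhds (s := Set.Iio lam))).and self_mem_nhdsWithin)).exists
    have := (Set.ext_iff.1 h1 j)
    rw [mem_activeSet_scad ha hX y hlam.le, mem_activeSet_scad ha hX y h2.le, hj] at this
    exact lt_irrefl _ (this.1 h3)

end Design

/-! ### Order statistics. -/

theorem exists_perm_antitone {p : ℕ} (v : Fin p → ℝ) :
    ∃ π : Equiv.Perm (Fin p), Antitone (v ∘ π) :=
  ⟨Tuple.sort (fun i => OrderDual.toDual (v i)), fun _ _ h =>
    Tuple.monotone_sort (fun i => OrderDual.toDual (v i)) h⟩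

theorem ncard_setOf_le_comp_perm {p : ℕ} (v : Fin p → ℝ) (π : Equiv.Perm (Fin p)) (t : ℝ) :
    {m : Fin p | t ≤ v (π m)}.ncard = {j : Fin p | t ≤ v j}.ncard := by
  rw [← Set.ncard_image_of_injective {m : Fin p | t ≤ v (π m)} π.injective]
  congr 1
  ext j
  constructor
  · rintro ⟨m, hm, rfl⟩
    exact hm
  · intro hj
    exact ⟨π.symm j, by simpa using hj, by simp⟩

theorem kthLargest_comp_perm {p : ℕ} (v : Fin p → ℝ) (π : Equiv.Perm (Fin p)) (k : ℕ) :
    kthLargest (v ∘ π) k = kthLargest v k := by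
  simp only [kthLargest, Function.comp_apply, ncard_setOf_le_comp_perm]

theorem le_ncard_of_antitone {p : ℕ} {v : Fin p → ℝ} {π : Equiv.Perm (Fin p)}
    (h : Antitone (v ∘ π)) (i : Fin p) (t : ℝ) :
    (i : ℕ) + 1 ≤ {j : Fin p | t ≤ v j}.ncard ↔ t ≤ v (π i) := by
  rw [← ncard_setOf_le_comp_perm v π t]
  constructor
  · intro hc
    by_contra hlt
    have hsub : {m : Fin p | t ≤ v (π m)} ⊆ Set.Iio i := by
      intro m hm
      by_contra hmi
      exact hlt (le_trans hm (h (not_lt.1 hmi)))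
    have := Set.ncard_le_ncard hsub
    rw [Set.ncard_eq_toFinset_card' (Set.Iio i), Set.toFinset_Iio, Fin.card_Iio] at this
    omega
  · intro ht
    have hsub : Set.Iic i ⊆ {m : Fin p | t ≤ v (π m)} := fun m hm => le_trans ht (h hm)
    have := Set.ncard_le_ncard hsub
    rwa [Set.ncard_eq_toFinset_card' (Set.Iic i), Set.toFinset_Iic, Fin.card_Iic] at this

theorem kthLargest_eq_of_antitone {p : ℕ} {v : Fin p → ℝ} {π : Equiv.Perm (Fin p)}
    (h : Antitone (v ∘ π)) (i : Fin p) : kthLargest v (i + 1) = v (π i) := by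
  have : {t : ℝ | (i : ℕ) + 1 ≤ {j : Fin p | t ≤ v j}.ncard} = Set.Iic (v (π i)) :=
    Set.ext fun t => le_ncard_of_antitone h i t
  rw [kthLargest, this, csSup_Iic]

theorem kthLargest_of_lt {p : ℕ} (v : Fin p → ℝ) {k : ℕ} (hk : p < k) : kthLargest v k = 0 := by
  have : {t : ℝ | k ≤ {j : Fin p | t ≤ v j}.ncard} = ∅ := by
    ext t
    simp only [Set.mem_ofPred_eq, Set.mem_empty_iff_false, iff_false, not_le]
    exact (Set.ncard_le_card _).trans_lt (by simpa using hk)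
  rw [kthLargest, this, Real.sSup_empty]

theorem le_kthLargest_iff {p : ℕ} (v : Fin p → ℝ) {k : ℕ} (hk : k < p) (t : ℝ) :
    t ≤ kthLargest v (k + 1) ↔ k + 1 ≤ {j : Fin p | t ≤ v j}.ncard := by
  obtain ⟨π, hπ⟩ := exists_perm_antitone v
  rw [kthLargest_eq_of_antitone hπ ⟨k, hk⟩, ← le_ncard_of_antitone hπ ⟨k, hk⟩ t]

theorem measurable_kthLargest (p k : ℕ) : Measurable fun v : Fin p → ℝ => kthLargest v (k + 1) := by
  rcases lt_or_ge k p with hk | hk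
  · refine measurable_of_Ici fun t => ?_
    have : (fun v : Fin p → ℝ => kthLargest v (k + 1)) ⁻¹' Set.Ici t =
        ⋃ s ∈ {s : Finset (Fin p) | k + 1 ≤ s.card}, ⋂ j ∈ s, {v : Fin p → ℝ | t ≤ v j} := by
      ext v
      simp only [Set.mem_preimage, Set.mem_Ici, le_kthLargest_iff v hk, Set.mem_iUnion,
        Set.mem_iInter, Set.mem_ofPred_eq, exists_prop]
      constructor
      · intro h
        refine ⟨Finset.univ.filter fun j => t ≤ v j, ?_, by simp⟩
        rwa [Set.ncard_eq_toFinset_card', Set.toFinset_ofPred] at h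
      · rintro ⟨s, hs, hst⟩
        rw [← Set.ncard_coe_finset] at hs
        exact hs.trans (Set.ncard_le_ncard fun j hj => hst j hj)
    rw [this]
    refine MeasurableSet.biUnion (Set.to_countable _) fun s _ =>
      MeasurableSet.biInter (Set.to_countable _) fun j _ => ?_
    exact measurableSet_le measurable_const (measurable_pi_apply j)
  · have : (fun v : Fin p → ℝ => kthLargest v (k + 1)) = fun _ => 0 := by
      ext v
      exact kthLargest_of_lt v (by omega)
    rw [this]
    exact measurable_const

theorem kthLargest_nonneg {p : ℕ} {v : Fin p → ℝ} (hv : ∀ j, 0 ≤ v j) (k : ℕ) :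
    0 ≤ kthLargest v (k + 1) := by
  rcases lt_or_ge k p with hk | hk
  · obtain ⟨π, hπ⟩ := exists_perm_antitone v
    rw [kthLargest_eq_of_antitone hπ ⟨k, hk⟩]
    exact hv _
  · rw [kthLargest_of_lt v (by omega)]

theorem kthLargest_succ_le {p : ℕ} {v : Fin p → ℝ} (hv : ∀ j, 0 ≤ v j) (k : ℕ) :
    kthLargest v (k + 2) ≤ kthLargest v (k + 1) := by
  rcases lt_or_ge (k + 1) p with hk | hk
  · obtain ⟨π, hπ⟩ := exists_perm_antitone v
    rw [kthLargest_eq_of_antitone hπ ⟨k, by omega⟩, kthLargest_eq_of_antitone hπ ⟨k + 1, hk⟩]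
    exact hπ (Nat.le_succ k)
  · rw [kthLargest_of_lt v (by omega : p < k + 2)]
    exact kthLargest_nonneg hv k

/-- The condition `f 0 = 0` serves the indices beyond `p`, where `kthLargest` takes the default
value `sSup ∅ = 0`. -/
theorem kthLargest_comp {p : ℕ} {v : Fin p → ℝ} {f : ℝ → ℝ} (hv : ∀ j, 0 ≤ v j)
    (hf : MonotoneOn f (Set.Ici 0)) (hf0 : f 0 = 0) (k : ℕ) :
    kthLargest (fun j => f (v j)) (k + 1) = f (kthLargest v (k + 1)) := by
  rcases lt_or_ge k p with hk | hk
  · obtain ⟨π, hπ⟩ := exists_perm_antitone v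
    have h2 : Antitone ((fun j => f (v j)) ∘ π) := fun i j hij => hf (hv _) (hv _) (hπ hij)
    rw [kthLargest_eq_of_antitone hπ ⟨k, hk⟩, kthLargest_eq_of_antitone h2 ⟨k, hk⟩]
  · rw [kthLargest_of_lt _ (by omega), kthLargest_of_lt _ (by omega), hf0]

/-- For distinct numbers, the next order statistic is the largest entry below the current one. -/
theorem isGreatest_range_inter_Iio_kthLargest {p : ℕ} {v : Fin p → ℝ} (hinj : Function.Injective v) (k : ℕ)
    (hk : k + 1 < p) :
    IsGreatest (Set.range v ∩ Set.Iio (kthLargest v (k + 1))) (kthLargest v (k + 2)) := by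
  obtain ⟨π, hπ⟩ := exists_perm_antitone v
  have hs : StrictAnti (v ∘ π) := hπ.strictAnti_of_injective (hinj.comp π.injective)
  rw [kthLargest_eq_of_antitone hπ ⟨k, by omega⟩, kthLargest_eq_of_antitone hπ ⟨k + 1, hk⟩]
  refine ⟨⟨⟨_, rfl⟩, hs (Nat.lt_succ_self k)⟩, ?_⟩
  rintro _ ⟨⟨j, rfl⟩, hj⟩
  obtain ⟨m, rfl⟩ := π.surjective j
  have : (⟨k, by omega⟩ : Fin p) < m := hs.lt_iff_gt.1 hj
  exact hπ (show (⟨k + 1, hk⟩ : Fin p) ≤ m from this)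

/-! ### Closed form of the covariance statistic. -/

section Design

variable {n p : ℕ} {X : Matrix (Fin n) (Fin p) ℝ} {a : ℝ}

theorem absCorrOrderStat_nonneg (X : Matrix (Fin n) (Fin p) ℝ) (y : Fin n → ℝ) (k : ℕ) :
    0 ≤ absCorrOrderStat X y (k + 1) :=
  kthLargest_nonneg (fun _ => abs_nonneg _) k

/-- Without ties, order statistics obey the recursion that defines the knots: each is the largest
value strictly below the previous one. Past index `p` both sides are `sSup ∅ = 0`. -/
theorem knot_scad (ha : 2 < a) (hX : Xᵀ * X = 1) (y : Fin n → ℝ)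
    (hinj : Function.Injective fun j => |(Xᵀ *ᵥ y) j|) (hne : ∀ j, (Xᵀ *ᵥ y) j ≠ 0) (k : ℕ) :
    knot (scadPenalty a) X y (k + 1) = absCorrOrderStat X y (k + 1) := by
  have hset : knotSet (scadPenalty a) X y = Set.range fun j => |(Xᵀ *ᵥ y) j| := by
    rw [knotSet_scad ha hX]
    apply Set.inter_eq_right.2
    rintro _ ⟨j, rfl⟩
    exact abs_pos.2 (hne j)
  have hempty : ∀ m, p ≤ m → knotSet (scadPenalty a) X y ∩
      Set.Iio (absCorrOrderStat X y (m + 1)) = ∅ := by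
    intro m hm
    rw [absCorrOrderStat, kthLargest_of_lt _ (by omega), hset]
    ext t
    simp only [Set.mem_inter_iff, Set.mem_range, Set.mem_Iio, Set.mem_empty_iff_false, iff_false]
    rintro ⟨⟨j, rfl⟩, h⟩
    exact absurd h (not_lt.2 (abs_nonneg _))
  induction k with
  | zero =>
    change sSup (knotSet (scadPenalty a) X y) = _
    rcases Nat.eq_zero_or_pos p with rfl | hp
    · rw [hset, absCorrOrderStat, kthLargest_of_lt _ (by omega), Set.range_eq_empty,
        Real.sSup_empty]
    · obtain ⟨π, hπ⟩ := exists_perm_antitone fun j => |(Xᵀ *ᵥ y) j|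
      have hg : IsGreatest (Set.range fun j => |(Xᵀ *ᵥ y) j|) |(Xᵀ *ᵥ y) (π ⟨0, hp⟩)| := by
        refine ⟨⟨_, rfl⟩, ?_⟩
        rintro _ ⟨j, rfl⟩
        obtain ⟨m, rfl⟩ := π.surjective j
        exact hπ (Nat.zero_le m)
      rw [hset, hg.csSup_eq]
      exact (kthLargest_eq_of_antitone hπ ⟨0, hp⟩).symm
  | succ k ih =>
    change sSup (knotSet (scadPenalty a) X y ∩ Set.Iio (knot (scadPenalty a) X y (k + 1))) = _
    rw [ih]
    rcases lt_trichotomy (k + 1) p with hk | hk | hk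
    · rw [hset]
      exact (isGreatest_range_inter_Iio_kthLargest hinj k hk).csSup_eq
    · have : knotSet (scadPenalty a) X y ∩ Set.Iio (absCorrOrderStat X y (k + 1)) = ∅ := by
        rw [hset]
        obtain ⟨π, hπ⟩ := exists_perm_antitone fun j => |(Xᵀ *ᵥ y) j|
        rw [absCorrOrderStat, kthLargest_eq_of_antitone hπ ⟨k, by omega⟩]
        ext t
        simp only [Set.mem_inter_iff, Set.mem_range, Set.mem_Iio, Set.mem_empty_iff_false,
          iff_false]
        rintro ⟨⟨j, rfl⟩, h⟩
        obtain ⟨m, rfl⟩ := π.surjective j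
        have hm : m ≤ (⟨k, by omega⟩ : Fin p) := by
          have := m.2
          change (m : ℕ) ≤ k
          omega
        exact absurd h (not_lt.2 (hπ hm))
      rw [this, absCorrOrderStat, kthLargest_of_lt _ (by omega), Real.sSup_empty]
    · rw [hempty k (by omega), absCorrOrderStat, kthLargest_of_lt _ (by omega), Real.sSup_empty]

theorem mem_activeBefore_scad (ha : 2 < a) (hX : Xᵀ * X = 1) (y : Fin n → ℝ) {k : ℕ}
    (hk : 0 ≤ knot (scadPenalty a) X y k) (j : Fin p) :
    j ∈ activeBefore (scadPenalty a) X y k ↔ knot (scadPenalty a) X y k < |(Xᵀ *ᵥ y) j| := by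
  rw [activeBefore, Set.mem_ofPred_eq]
  have : ∀ᶠ l in 𝓝[>] knot (scadPenalty a) X y k,
      (j ∈ activeSet (scadPenalty a) X y l ↔ l < |(Xᵀ *ᵥ y) j|) := by
    filter_upwards [self_mem_nhdsWithin] with l hl
    exact mem_activeSet_scad ha hX y (hk.trans (le_of_lt hl)) j
  rw [eventually_congr this]
  constructor
  · intro h
    obtain ⟨l, h1, h2⟩ := (h.and self_mem_nhdsWithin).exists
    exact lt_trans h2 h1
  · intro h
    exact (gt_mem_nhds h).filter_mono nhdsWithin_le_nhds

theorem mul_scadThreshold_div {σ V W : ℝ} (ha : 2 < a) (hVW : W ≤ V) :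
    V * scadThreshold a W V / σ ^ 2 = scadFormula a σ V W := by
  have h1 : a - 1 ≠ 0 := by linarith
  have h2 : a - 2 ≠ 0 := by linarith
  unfold scadThreshold scadFormula
  split_ifs with h h'
  · rw [max_eq_left (by linarith)]
  · congr 1
    field_simp
  · rw [sq V]

theorem covStat_scad_eq (ha : 2 < a) (σ : ℝ) (hX : Xᵀ * X = 1) (y : Fin n → ℝ)
    (hinj : Function.Injective fun j => |(Xᵀ *ᵥ y) j|) (hne : ∀ j, (Xᵀ *ᵥ y) j ≠ 0) (k : ℕ) :
    covStat (scadPenalty a) σ X y (k + 1) =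
      scadFormula a σ (absCorrOrderStat X y (k + 1)) (absCorrOrderStat X y (k + 2)) := by
  classical
  have hV := absCorrOrderStat_nonneg X y k
  have hW := absCorrOrderStat_nonneg X y (k + 1)
  have hWV : absCorrOrderStat X y (k + 2) ≤ absCorrOrderStat X y (k + 1) :=
    kthLargest_succ_le (fun _ => abs_nonneg _) k
  have hk1 := knot_scad ha hX y hinj hne k
  have hk2 := knot_scad ha hX y hinj hne (k + 1)
  rw [← mul_scadThreshold_div ha hWV, covStat, hk2, penLS_scad ha hX _ _ hW,
    penLS_scad ha hX _ _ hW]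
  congr 1
  rw [dotProduct_mulVec, dotProduct_mulVec, ← mulVec_transpose, ← dotProduct_sub]
  set V := absCorrOrderStat X y (k + 1) with hVdef
  set W := absCorrOrderStat X y (k + 2) with hWdef
  set z := Xᵀ *ᵥ y with hz
  have hterm : ∀ j, z j * (scadEstimate a z Set.univ W -
      scadEstimate a z (activeBefore (scadPenalty a) X y (k + 1)) W) j =
      if |z j| ≤ V then |z j| * scadThreshold a W |z j| else 0 := by
    intro j
    have hs : z j * ((z j).sign * scadThreshold a W |z j|) = |z j| * scadThreshold a W |z j| := by
      rw [← mul_assoc]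
      congr 1
      rcases lt_trichotomy (z j) 0 with h | h | h
      · rw [Real.sign_of_neg h, abs_of_neg h]; ring
      · rw [h]; simp
      · rw [Real.sign_of_pos h, abs_of_pos h]; ring
    have hmem := mem_activeBefore_scad ha hX y (k := k + 1) (hk1 ▸ hV) j
    rw [hk1, ← hz, ← not_le] at hmem
    simp only [Pi.sub_apply, scadEstimate, Set.mem_univ, if_true, hmem]
    by_cases h : |z j| ≤ V
    · simp [h, hs]
    · simp [h]
  rw [dotProduct, Finset.sum_congr rfl fun j _ => hterm j]
  have hzero : ∀ j, |z j| ≤ W → |z j| * scadThreshold a W |z j| = 0 := by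
    intro j hj
    rw [mul_eq_zero]
    right
    by_contra hne0
    have := (scadThreshold_pos_iff (z := |z j|) ha hW).1
      ((scadThreshold_nonneg ha hW).lt_of_ne (Ne.symm hne0))
    linarith
  rcases lt_or_ge k p with hk | hk
  · obtain ⟨π, hπ⟩ := exists_perm_antitone fun j => |z j|
    have hs : StrictAnti ((fun j => |z j|) ∘ π) :=
      hπ.strictAnti_of_injective (hinj.comp π.injective)
    have hVπ : V = |z (π ⟨k, hk⟩)| := kthLargest_eq_of_antitone hπ ⟨k, hk⟩
    rw [Finset.sum_eq_single (π ⟨k, hk⟩)]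
    · rw [← hVπ, if_pos le_rfl]
    · intro j _ hj
      obtain ⟨m, rfl⟩ := π.surjective j
      split_ifs with h
      · apply hzero
        rw [hVπ] at h
        have hkm : (⟨k, hk⟩ : Fin p) ≤ m := hs.le_iff_ge.1 h
        have hkm' : k < m := by
          refine lt_of_le_of_ne hkm fun h => hj ?_
          congr 1
          exact Fin.ext h.symm
        have hWπ : W = |z (π ⟨k + 1, by omega⟩)| :=
          kthLargest_eq_of_antitone hπ ⟨k + 1, by omega⟩
        rw [hWπ]
        exact hπ (show (⟨k + 1, by omega⟩ : Fin p) ≤ m from hkm')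
      · rfl
    · simp
  -- For `k ≥ p` both sides are `0`; covering this case lets the formula serve for measurability at
  -- every `p`.
  · have hV0 : V = 0 := kthLargest_of_lt _ (by omega)
    rw [hV0, zero_mul]
    refine Finset.sum_eq_zero fun j _ => ?_
    split_ifs with h
    · have : |z j| = 0 := le_antisymm h (abs_nonneg _)
      rw [this, zero_mul]
    · rfl

end Design

/-! ### Product measures and Rényi's representation. -/

theorem lintegral_fin_prod_eq_prod {n : ℕ} (μ : Fin n → Measure ℝ) [∀ i, SigmaFinite (μ i)]
    {f : Fin n → ℝ → ℝ≥0∞} (hf : ∀ i, Measurable (f i)) :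
    ∫⁻ x, ∏ i, f i (x i) ∂Measure.pi μ = ∏ i, ∫⁻ t, f i t ∂μ i := by
  induction n with
  | zero => simp
  | succ n ih =>
    have hmeas : Measurable fun x : Fin (n + 1) → ℝ => ∏ i, f i (x i) :=
      Finset.measurable_fun_prod _ fun i _ => (hf i).comp (measurable_pi_apply i)
    rw [← (measurePreserving_piFinSuccAbove μ 0).symm.lintegral_comp hmeas]
    simp_rw [MeasurableEquiv.piFinSuccAbove_symm_apply, Fin.insertNthEquiv,
      Fin.prod_univ_succ, Fin.insertNth_zero]
    simp only [Fin.zero_succAbove, Equiv.coe_fn_mk, Fin.cons_zero, Fin.cons_succ, cast_eq]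
    rw [lintegral_prod_mul (f := f 0) (g := fun x : Fin n → ℝ => ∏ i, f i.succ (x i))
      (hf 0).aemeasurable
      (Finset.measurable_fun_prod _ fun i _ =>
        (hf i.succ).comp (measurable_pi_apply i)).aemeasurable, ih _ fun i => hf i.succ]

theorem pi_withDensity_eq {n : ℕ} {f : Fin n → ℝ → ℝ≥0∞} (hf : ∀ i, Measurable (f i))
    [∀ i, SigmaFinite ((volume : Measure ℝ).withDensity (f i))] :
    (Measure.pi fun i => (volume : Measure ℝ).withDensity (f i)) =
      (volume : Measure (Fin n → ℝ)).withDensity fun x => ∏ i, f i (x i) := by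
  refine Measure.pi_eq fun s hs => ?_
  rw [withDensity_apply _ (MeasurableSet.univ_pi hs), volume_pi, Measure.restrict_pi_pi,
    lintegral_fin_prod_eq_prod _ hf]
  exact Finset.prod_congr rfl fun i _ => (withDensity_apply _ (hs i)).symm

theorem map_pi_precomp {m n : ℕ} (μ : Fin n → Measure ℝ) [∀ i, IsProbabilityMeasure (μ i)]
    {g : Fin m → Fin n} (hg : Function.Injective g) :
    (Measure.pi μ).map (fun x i => x (g i)) = Measure.pi fun i => μ (g i) := by
  have h := (iIndepFun_pi (μ := μ) (X := fun _ => id) fun _ => aemeasurable_id).precomp hg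
  refine ((iIndepFun_iff_map_fun_eq_pi_map (f := fun i (x : Fin n → ℝ) => x (g i))
    fun i => (measurable_pi_apply (g i)).aemeasurable).1 h).trans ?_
  congr 1
  ext1 i
  exact (measurePreserving_eval μ (g i)).map_eq

theorem measurePreserving_comp_perm {n : ℕ} (μ : Measure ℝ) [SigmaFinite μ]
    (π : Equiv.Perm (Fin n)) :
    MeasurePreserving (fun x : Fin n → ℝ => x ∘ π) (Measure.pi fun _ => μ)
      (Measure.pi fun _ => μ) := by
  convert measurePreserving_piCongrLeft (fun _ : Fin n => μ) π.symm using 1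
  ext x i
  obtain ⟨j, rfl⟩ := π.symm.surjective i
  rw [MeasurableEquiv.coe_piCongrLeft, Equiv.piCongrLeft_apply_apply]
  simp

/-- The upper triangular matrix with all entries `1` on and above the diagonal. -/
def tailSumMatrix (p : ℕ) : Matrix (Fin p) (Fin p) ℝ :=
  Matrix.of fun i j => if i ≤ j then 1 else 0

theorem det_tailSumMatrix (p : ℕ) : (tailSumMatrix p).det = 1 := by
  rw [Matrix.det_of_isUpperTriangular]
  · simp [tailSumMatrix]
  · intro i j hij
    simp only [id_eq] at hij
    simp [tailSumMatrix, not_le.2 hij]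

theorem measurePreserving_tailSum (p : ℕ) :
    MeasurePreserving (fun d : Fin p → ℝ => tailSumMatrix p *ᵥ d) volume volume := by
  refine ⟨by fun_prop, ?_⟩
  have := Real.map_matrix_volume_pi_eq_smul_volume_pi (M := tailSumMatrix p)
    (by rw [det_tailSumMatrix]; exact one_ne_zero)
  rw [det_tailSumMatrix] at this
  simpa using! this

/-- The sum of the entries of `d` with index at least `k`. -/
def tailSum {p : ℕ} (d : Fin p → ℝ) (k : ℕ) : ℝ := ∑ j : Fin p, if k ≤ (j : ℕ) then d j else 0

theorem tailSumMatrix_mulVec {p : ℕ} (d : Fin p → ℝ) (i : Fin p) :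
    (tailSumMatrix p *ᵥ d) i = tailSum d i := by
  simp [tailSumMatrix, tailSum, mulVec, dotProduct]

theorem tailSum_sub_tailSum_succ {p : ℕ} (d : Fin p → ℝ) (i : Fin p) :
    tailSum d i - tailSum d (i + 1) = d i := by
  rw [tailSum, tailSum, ← Finset.sum_sub_distrib, Finset.sum_eq_single i]
  · simp
  · intro j _ hj
    have : (j : ℕ) ≠ i := fun h => hj (Fin.ext h)
    by_cases h : (i : ℕ) ≤ j
    · rw [if_pos h, if_pos (by omega), sub_self]
    · rw [if_neg h, if_neg (by omega), sub_self]
  · simp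

theorem tailSum_of_le {p : ℕ} (d : Fin p → ℝ) {k : ℕ} (hk : p ≤ k) : tailSum d k = 0 :=
  Finset.sum_eq_zero fun j _ => if_neg (by omega)

theorem antitone_tailSum {p : ℕ} {d : Fin p → ℝ} (hd : ∀ i, 0 ≤ d i) : Antitone (tailSum d) := by
  intro k l hkl
  refine Finset.sum_le_sum fun j _ => ?_
  by_cases h : l ≤ j
  · rw [if_pos h, if_pos (hkl.trans h)]
  · rw [if_neg h]
    split_ifs
    · exact hd j
    · exact le_rfl

/-- The source of the rates: the gap `d j` is counted once in each of the top `j + 1` order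
statistics. -/
theorem sum_tailSum {p : ℕ} (d : Fin p → ℝ) :
    ∑ i : Fin p, tailSum d i = ∑ j : Fin p, ((j : ℕ) + 1 : ℝ) * d j := by
  simp only [tailSum]
  rw [Finset.sum_comm]
  refine Finset.sum_congr rfl fun j _ => ?_
  have : (Finset.univ.filter fun i : Fin p => (i : ℕ) ≤ j) = Finset.Iic j := by
    ext i; simp
  rw [← Finset.sum_filter, Finset.sum_const, this, Fin.card_Iic, nsmul_eq_mul]
  push_cast
  ring

/-- The gaps between consecutive order statistics; the last one is the smallest entry. -/
noncomputable def spacings {p : ℕ} (x : Fin p → ℝ) (i : Fin p) : ℝ :=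
  kthLargest x (i + 1) - kthLargest x (i + 2)

theorem measurable_spacings (p : ℕ) : Measurable (spacings (p := p)) :=
  measurable_pi_lambda _ fun i => (measurable_kthLargest p i).sub (measurable_kthLargest p (i + 1))

theorem kthLargest_of_antitone {p : ℕ} {x : Fin p → ℝ} (h : Antitone x) (i : Fin p) :
    kthLargest x (i + 1) = x i :=
  kthLargest_eq_of_antitone (π := 1) h i

theorem spacings_tailSum {p : ℕ} {d : Fin p → ℝ} (h : Antitone (tailSumMatrix p *ᵥ d)) :
    spacings (tailSumMatrix p *ᵥ d) = d := by
  ext i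
  rw [spacings, kthLargest_of_antitone h, tailSumMatrix_mulVec]
  rw [← tailSum_sub_tailSum_succ d i]
  congr 1
  rcases lt_or_ge ((i : ℕ) + 1) p with hi | hi
  · rw [kthLargest_of_antitone h ⟨i + 1, hi⟩, tailSumMatrix_mulVec]
  · rw [kthLargest_of_lt _ (by omega), tailSum_of_le _ hi]

theorem prod_exponentialPDF_tailSum {p : ℕ} (d : Fin p → ℝ) (hd : ∀ i, 0 ≤ d i) :
    ∏ i, exponentialPDF 1 ((tailSumMatrix p *ᵥ d) i) =
      ∏ i : Fin p, (ENNReal.ofReal ((i : ℕ) + 1 : ℝ)⁻¹ * exponentialPDF ((i : ℕ) + 1) (d i)) := by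
  have h1 : ∀ i : Fin p, exponentialPDF 1 ((tailSumMatrix p *ᵥ d) i) =
      ENNReal.ofReal (Real.exp (-tailSum d i)) := by
    intro i
    rw [tailSumMatrix_mulVec, exponentialPDF_of_nonneg]
    · simp
    · rw [← tailSum_of_le d le_rfl]
      exact antitone_tailSum hd i.2.le
  have h2 : ∀ i : Fin p, ENNReal.ofReal ((i : ℕ) + 1 : ℝ)⁻¹ * exponentialPDF ((i : ℕ) + 1) (d i) =
      ENNReal.ofReal (Real.exp (-(((i : ℕ) + 1) * d i))) := by
    intro i
    rw [exponentialPDF_of_nonneg (hd i), ← ENNReal.ofReal_mul (by positivity), ← mul_assoc,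
      inv_mul_cancel₀ (by positivity), one_mul]
  simp only [h1, h2]
  rw [← ENNReal.ofReal_prod_of_nonneg fun _ _ => (Real.exp_pos _).le,
    ← ENNReal.ofReal_prod_of_nonneg fun _ _ => (Real.exp_pos _).le, ← Real.exp_sum, ← Real.exp_sum,
    Finset.sum_neg_distrib, Finset.sum_neg_distrib, sum_tailSum]

theorem measurable_exponentialPDF (r : ℝ) : Measurable (exponentialPDF r) :=
  (measurable_exponentialPDFReal r).ennreal_ofReal

theorem sigmaFinite_withDensity_exponentialPDF (r : ℝ) :
    SigmaFinite ((volume : Measure ℝ).withDensity (exponentialPDF r)) :=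
  SigmaFinite.withDensity_of_ne_top
    (Eventually.of_forall fun _ => ENNReal.ofReal_ne_top)

theorem pi_expMeasure_eq {p : ℕ} (r : Fin p → ℝ) :
    (Measure.pi fun i => expMeasure (r i)) =
      (volume : Measure (Fin p → ℝ)).withDensity fun x => ∏ i, exponentialPDF (r i) (x i) := by
  have := fun i => sigmaFinite_withDensity_exponentialPDF (r i)
  exact pi_withDensity_eq (f := fun i => exponentialPDF (r i)) fun i => measurable_exponentialPDF (r i)

/-- A tie puts the vector in one of finitely many hyperplanes `x i = x j`, which are Lebesgue null.
-/
theorem ae_injective_pi_expMeasure (p : ℕ) :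
    ∀ᵐ x ∂(Measure.pi fun _ : Fin p => expMeasure 1), Function.Injective x := by
  rw [pi_expMeasure_eq]
  refine (withDensity_absolutelyContinuous _ _).ae_le ?_
  have : ∀ i j : Fin p, i ≠ j → ∀ᵐ x : Fin p → ℝ, x i ≠ x j := by
    intro i j hij
    have h := Measure.addHaar_submodule (volume : Measure (Fin p → ℝ))
      (LinearMap.ker (LinearMap.proj (R := ℝ) (φ := fun _ : Fin p => ℝ) i -
        LinearMap.proj (R := ℝ) (φ := fun _ : Fin p => ℝ) j)) (by
        intro htop
        rw [LinearMap.ker_eq_top] at htop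
        have := LinearMap.congr_fun htop (Pi.single i 1)
        simp [hij.symm] at this)
    rw [ae_iff]
    convert h using 2
    ext x
    simp [sub_eq_zero]
  have h2 : ∀ᵐ x : Fin p → ℝ, ∀ i j : Fin p, i ≠ j → x i ≠ x j :=
    ae_all_iff.2 fun i => ae_all_iff.2 fun j => by
      by_cases hij : i = j
      · exact Eventually.of_forall fun _ h => absurd hij h
      · filter_upwards [this i j hij] with x hx _ using hx
  filter_upwards [h2] with x hx i j hij
  by_contra hne
  exact hx i j hne hij

theorem measurableSet_antitone (p : ℕ) : MeasurableSet {x : Fin p → ℝ | Antitone x} := by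
  have : {x : Fin p → ℝ | Antitone x} = ⋂ i, ⋂ j, ⋂ _ : i ≤ j, {x | x j ≤ x i} := by
    ext x
    simp [Antitone]
  rw [this]
  exact MeasurableSet.iInter fun i => MeasurableSet.iInter fun j => MeasurableSet.iInter fun _ =>
    measurableSet_le (measurable_pi_apply j) (measurable_pi_apply i)

/-- Rényi's representation on one ordering chamber, by the volume-preserving substitution that
recovers a decreasing vector from its gaps. -/
theorem pi_expMeasure_antitone_inter {p : ℕ} {B : Set (Fin p → ℝ)} (hB : MeasurableSet B) :
    (Measure.pi fun _ : Fin p => expMeasure 1) (spacings ⁻¹' B ∩ {x | Antitone x}) =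
      (∏ i : Fin p, ENNReal.ofReal ((i : ℕ) + 1 : ℝ)⁻¹) *
        (Measure.pi fun i : Fin p => expMeasure ((i : ℕ) + 1)) B := by
  have hE : MeasurableSet (spacings ⁻¹' B ∩ {x : Fin p → ℝ | Antitone x}) :=
    (measurable_spacings p hB).inter (measurableSet_antitone p)
  have hmeas : ∀ r : Fin p → ℝ, Measurable fun x : Fin p → ℝ => ∏ i, exponentialPDF (r i) (x i) :=
    fun r => Finset.measurable_fun_prod _ fun i _ =>
      (measurable_exponentialPDF _).comp (measurable_pi_apply i)
  rw [pi_expMeasure_eq, pi_expMeasure_eq, withDensity_apply _ hE, withDensity_apply _ hB,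
    ← lintegral_const_mul _ (hmeas _), ← lintegral_indicator hE, ← lintegral_indicator hB,
    ← (measurePreserving_tailSum p).lintegral_comp ((hmeas _).indicator hE)]
  refine lintegral_congr fun d => ?_
  classical
  rw [Set.indicator_apply, Set.indicator_apply]
  by_cases hd : ∀ i, 0 ≤ d i
  · have hanti : Antitone (tailSumMatrix p *ᵥ d) := by
      intro i j hij
      rw [tailSumMatrix_mulVec, tailSumMatrix_mulVec]
      exact antitone_tailSum hd hij
    simp only [Set.mem_inter_iff, Set.mem_preimage, Set.mem_ofPred_eq, hanti, and_true,
      spacings_tailSum hanti]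
    rw [prod_exponentialPDF_tailSum d hd, Finset.prod_mul_distrib]
  -- With a negative gap both integrands vanish: either the vector is not decreasing, or the gap is
  -- the last one and equals a negative last entry.
  · push Not at hd
    obtain ⟨i, hi⟩ := hd
    have hright : ∏ i : Fin p, exponentialPDF ((i : ℕ) + 1) (d i) = 0 :=
      Finset.prod_eq_zero (Finset.mem_univ i) (exponentialPDF_of_neg hi)
    rw [hright, mul_zero, ite_self]
    split_ifs with h
    · have hanti : Antitone (tailSumMatrix p *ᵥ d) := h.2
      have hdi := tailSum_sub_tailSum_succ d i
      rcases lt_or_ge ((i : ℕ) + 1) p with hip | hip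
      · have := hanti (show i ≤ ⟨i + 1, hip⟩ from Nat.le_succ i)
        rw [tailSumMatrix_mulVec, tailSumMatrix_mulVec] at this
        simp only at this
        linarith
      · rw [tailSum_of_le _ hip, sub_zero] at hdi
        refine Finset.prod_eq_zero (Finset.mem_univ i) (exponentialPDF_of_neg ?_)
        rw [tailSumMatrix_mulVec, hdi]
        exact hi
    · rfl

/-- **Rényi's representation**: the gaps between the order statistics of `p` independent standard
exponential variables are independent, the `i`-th one (from the top) being exponential of rate
`i`. -/
theorem map_spacings_pi_expMeasure (p : ℕ) :
    (Measure.pi fun _ : Fin p => expMeasure 1).map spacings =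
      Measure.pi fun i : Fin p => expMeasure ((i : ℕ) + 1) := by
  have := isProbabilityMeasure_expMeasure (zero_lt_one (α := ℝ))
  ext B hB
  rw [Measure.map_apply (measurable_spacings p) hB]
  set μ := Measure.pi fun _ : Fin p => expMeasure 1 with hμ
  set R : Equiv.Perm (Fin p) → Set (Fin p → ℝ) := fun π => (fun x => x ∘ π) ⁻¹' {x | Antitone x}
    with hR
  have hRm : ∀ π, MeasurableSet (R π) := fun π =>
    (measurePreserving_comp_perm (expMeasure 1) π).measurable (measurableSet_antitone p)
  have hunion : spacings ⁻¹' B = ⋃ π, (spacings ⁻¹' B ∩ R π) := by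
    rw [← Set.inter_iUnion]
    refine (Set.inter_eq_left.2 fun x _ => ?_).symm
    obtain ⟨π, hπ⟩ := exists_perm_antitone x
    exact Set.mem_iUnion.2 ⟨π, hπ⟩
  have hdisj : Pairwise (Function.onFun (AEDisjoint μ) fun π => spacings ⁻¹' B ∩ R π) := by
    intro π₁ π₂ hne
    refine measure_mono_null (t := {x | ¬ Function.Injective x}) ?_
      (ae_iff.1 (ae_injective_pi_expMeasure p))
    rintro x ⟨⟨_, h1⟩, ⟨_, h2⟩⟩ hinj
    apply hne
    have h1' : ∀ i : Fin p, kthLargest x (i + 1) = x (π₁ i) := fun i =>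
      kthLargest_eq_of_antitone h1 i
    have h2' : ∀ i : Fin p, kthLargest x (i + 1) = x (π₂ i) := fun i =>
      kthLargest_eq_of_antitone h2 i
    ext1 i
    exact hinj ((h1' i).symm.trans (h2' i))
  have hperm : ∀ π, μ (spacings ⁻¹' B ∩ R π) = μ (spacings ⁻¹' B ∩ {x | Antitone x}) := by
    intro π
    rw [← (measurePreserving_comp_perm (expMeasure 1) π).measure_preimage
      ((measurable_spacings p hB).inter (measurableSet_antitone p)).nullMeasurableSet]
    congr 1
    rw [Set.preimage_inter]
    congr 1
    ext x
    have : spacings (x ∘ π) = spacings x := by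
      ext i
      rw [spacings, spacings, kthLargest_comp_perm, kthLargest_comp_perm]
    simp only [Set.mem_preimage, this]
  rw [hunion, measure_iUnion₀ hdisj fun π =>
    ((measurable_spacings p hB).inter (hRm π)).nullMeasurableSet, tsum_fintype]
  simp only [hperm]
  rw [Finset.sum_const, Finset.card_univ, Fintype.card_perm, Fintype.card_fin,
    pi_expMeasure_antitone_inter hB, nsmul_eq_mul, ← mul_assoc]
  -- The number `p!` of chambers cancels the normalizing constants of the rates `1, ..., p`.
  have hfact : ((p.factorial : ℕ) : ℝ≥0∞) * ∏ i : Fin p, ENNReal.ofReal ((i : ℕ) + 1 : ℝ)⁻¹ = 1 := by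
    rw [← ENNReal.ofReal_prod_of_nonneg fun _ _ => by positivity, ← ENNReal.ofReal_natCast,
      ← ENNReal.ofReal_mul (by positivity), ← Finset.prod_range_add_one_eq_factorial,
      ← Fin.prod_univ_eq_prod_range (fun i => i + 1) p]
    push_cast
    rw [← Finset.prod_mul_distrib, Finset.prod_eq_one fun i _ => mul_inv_cancel₀ (by positivity),
      ENNReal.ofReal_one]
  rw [hfact, one_mul]

theorem map_first_spacings_pi_expMeasure {k p : ℕ} (hk : k ≤ p) :
    (Measure.pi fun _ : Fin p => expMeasure 1).map
      (fun x (i : Fin k) => kthLargest x (i + 1) - kthLargest x (i + 2)) = expLimitLaw k := by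
  have : ∀ i : Fin p, IsProbabilityMeasure (expMeasure (((i : ℕ) : ℝ) + 1)) :=
    fun i => isProbabilityMeasure_expMeasure (by positivity)
  have h := map_pi_precomp (fun i : Fin p => expMeasure (((i : ℕ) : ℝ) + 1))
    (Fin.castLE_injective hk)
  rw [← map_spacings_pi_expMeasure, Measure.map_map (by fun_prop) (measurable_spacings p)] at h
  exact h

/-! ### The half-normal tail, Mills ratio and hazard. -/

theorem integrable_exp_neg_sq_div_two : Integrable fun t : ℝ => Real.exp (-t ^ 2 / 2) := by
  have h := integrable_exp_neg_mul_sq (b := 1 / 2) (by norm_num)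
  refine h.congr (Eventually.of_forall fun t => ?_)
  simp only
  congr 1
  ring

/-- The tail probability `P(|Z| > x)` of a standard normal variable `Z`, for `x ≥ 0`. -/
noncomputable def halfNormalTail (x : ℝ) : ℝ :=
  2 * (√(2 * Real.pi))⁻¹ * ∫ t in Set.Ioi x, Real.exp (-t ^ 2 / 2)

/-- The factor `∫ s > 0, exp (-(x * s) - s ^ 2 / 2)` by which the tail of the normal law differs
from its density. -/
noncomputable def millsIntegral (x : ℝ) : ℝ :=
  ∫ s in Set.Ioi (0 : ℝ), Real.exp (-(x * s) - s ^ 2 / 2)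

theorem halfNormalTail_eq (x : ℝ) :
    halfNormalTail x = 2 * (√(2 * Real.pi))⁻¹ * Real.exp (-x ^ 2 / 2) * millsIntegral x := by
  rw [halfNormalTail, millsIntegral, mul_assoc _ (Real.exp _)]
  congr 1
  have h := (measurePreserving_add_left (volume : Measure ℝ) x).setIntegral_preimage_emb
    (measurableEmbedding_addLeft x) (fun t => Real.exp (-t ^ 2 / 2)) (Set.Ioi x)
  have hpre : (fun s => x + s) ⁻¹' Set.Ioi x = Set.Ioi 0 := by
    ext s; simp
  rw [← h, hpre, ← integral_const_mul]
  refine integral_congr_ae (Eventually.of_forall fun s => ?_)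
  simp only [← Real.exp_add]
  congr 1
  ring

theorem integrableOn_mills {x : ℝ} (hx : 0 ≤ x) :
    IntegrableOn (fun s : ℝ => Real.exp (-(x * s) - s ^ 2 / 2)) (Set.Ioi 0) := by
  refine Integrable.mono' integrable_exp_neg_sq_div_two.integrableOn
    (by fun_prop : Continuous fun s : ℝ => Real.exp (-(x * s) - s ^ 2 / 2)).aestronglyMeasurable ?_
  filter_upwards [ae_restrict_mem measurableSet_Ioi] with s hs
  rw [Real.norm_eq_abs, abs_of_pos (Real.exp_pos _), Real.exp_le_exp]
  have : 0 ≤ x * s := mul_nonneg hx (le_of_lt hs)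
  linarith

theorem millsIntegral_pos {x : ℝ} (hx : 0 ≤ x) : 0 < millsIntegral x := by
  rw [millsIntegral, setIntegral_pos_iff_support_of_nonneg_ae
    (Eventually.of_forall fun s => (Real.exp_pos _).le) (integrableOn_mills hx)]
  have : (Function.support fun s : ℝ => Real.exp (-(x * s) - s ^ 2 / 2)) = Set.univ := by
    ext s; simp
  rw [this, Set.univ_inter, Real.volume_Ioi]
  exact ENNReal.zero_lt_top

theorem millsIntegral_anti {w v : ℝ} (hw : 0 ≤ w) (hwv : w ≤ v) :
    millsIntegral v ≤ millsIntegral w := by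
  refine setIntegral_mono_on (integrableOn_mills (hw.trans hwv)) (integrableOn_mills hw)
    measurableSet_Ioi fun s hs => ?_
  rw [Real.exp_le_exp]
  have : w * s ≤ v * s := mul_le_mul_of_nonneg_right hwv (le_of_lt hs)
  linarith

theorem mul_millsIntegral_eq {x : ℝ} (hx : 0 < x) :
    x * millsIntegral x = ∫ u in Set.Ioi (0 : ℝ), Real.exp (-u - u ^ 2 / (2 * x ^ 2)) := by
  have h := integral_comp_mul_left_Ioi' (fun u => Real.exp (-u - u ^ 2 / (2 * x ^ 2))) 0 hx
  rw [mul_zero, smul_eq_mul] at h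
  rw [← h, millsIntegral]
  congr 1
  refine integral_congr_ae (Eventually.of_forall fun s => ?_)
  simp only
  congr 1
  field_simp

/-- After the substitution `u = x s` the integrand increases with `x` pointwise. Together with
`millsIntegral_anti` this bounds the change of the log Mills factor on both sides. -/
theorem mul_millsIntegral_mono {w v : ℝ} (hw : 0 < w) (hwv : w ≤ v) :
    w * millsIntegral w ≤ v * millsIntegral v := by
  have hint : ∀ x : ℝ, IntegrableOn (fun u : ℝ => Real.exp (-u - u ^ 2 / (2 * x ^ 2)))
      (Set.Ioi 0) := by
    intro x
    have h1 := exp_neg_integrableOn_Ioi 0 (zero_lt_one (α := ℝ))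
    refine Integrable.mono' h1 (by fun_prop : Continuous fun u : ℝ =>
      Real.exp (-u - u ^ 2 / (2 * x ^ 2))).aestronglyMeasurable
      (Eventually.of_forall fun u => ?_)
    rw [Real.norm_eq_abs, abs_of_pos (Real.exp_pos _), Real.exp_le_exp]
    have : 0 ≤ u ^ 2 / (2 * x ^ 2) := by positivity
    linarith
  rw [mul_millsIntegral_eq hw, mul_millsIntegral_eq (hw.trans_le hwv)]
  refine setIntegral_mono_on (hint w) (hint v) measurableSet_Ioi fun u _ => ?_
  rw [Real.exp_le_exp]
  have : u ^ 2 / (2 * v ^ 2) ≤ u ^ 2 / (2 * w ^ 2) := by gcongr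
  linarith

theorem halfNormalTail_zero : halfNormalTail 0 = 1 := by
  have h : ∫ t in Set.Ioi (0 : ℝ), Real.exp (-t ^ 2 / 2) = √(2 * Real.pi) / 2 := by
    have := integral_gaussian_Ioi (1 / 2)
    rw [show Real.pi / (1 / 2) = 2 * Real.pi by ring] at this
    rw [← this]
    refine integral_congr_ae (Eventually.of_forall fun s => ?_)
    simp only
    congr 1
    ring
  rw [halfNormalTail, h]
  have : √(2 * Real.pi) ≠ 0 := (Real.sqrt_pos.2 (by positivity)).ne'
  field_simp

theorem halfNormalTail_pos {x : ℝ} (hx : 0 ≤ x) : 0 < halfNormalTail x := by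
  rw [halfNormalTail_eq]
  have := millsIntegral_pos hx
  have := Real.sqrt_pos.2 (show 0 < 2 * Real.pi by positivity)
  positivity

theorem continuous_halfNormalTail : Continuous halfNormalTail := by
  have h : ∀ x, halfNormalTail x = 2 * (√(2 * Real.pi))⁻¹ *
      ((∫ t in Set.Ioi 0, Real.exp (-t ^ 2 / 2)) - ∫ t in (0 : ℝ)..x, Real.exp (-t ^ 2 / 2)) := by
    intro x
    rw [halfNormalTail, ← intervalIntegral.integral_interval_add_Ioi
      (a := 0) (b := x) integrable_exp_neg_sq_div_two.integrableOn
      integrable_exp_neg_sq_div_two.integrableOn, add_sub_cancel_left]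
  rw [show halfNormalTail = _ from funext h]
  exact continuous_const.mul (continuous_const.sub
    (intervalIntegral.continuous_primitive
      (fun _ _ => integrable_exp_neg_sq_div_two.intervalIntegrable) 0))

theorem gaussianReal_abs_gt {x : ℝ} (hx : 0 ≤ x) :
    gaussianReal 0 1 {z | x < |z|} = ENNReal.ofReal (halfNormalTail x) := by
  have hunion : {z : ℝ | x < |z|} = Set.Ioi x ∪ (fun z => -z) ⁻¹' Set.Ioi x := by
    ext z
    rw [Set.mem_ofPred_eq, lt_abs]
    rfl
  have hdisj : Disjoint (Set.Ioi x) ((fun z : ℝ => -z) ⁻¹' Set.Ioi x) := by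
    rw [Set.disjoint_left]
    intro z (h1 : x < z) (h2 : x < -z)
    linarith
  have hneg : gaussianReal 0 1 ((fun z => -z) ⁻¹' Set.Ioi x) = gaussianReal 0 1 (Set.Ioi x) := by
    rw [← Measure.map_apply measurable_neg measurableSet_Ioi, gaussianReal_map_neg, neg_zero]
  have hpdf : ∫ t in Set.Ioi x, gaussianPDFReal 0 1 t =
      (√(2 * Real.pi))⁻¹ * ∫ t in Set.Ioi x, Real.exp (-t ^ 2 / 2) := by
    rw [← integral_const_mul]
    simp [gaussianPDFReal]
  rw [hunion, measure_union hdisj (measurable_neg measurableSet_Ioi), hneg,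
    gaussianReal_apply_eq_integral _ one_ne_zero, hpdf, halfNormalTail, mul_assoc, ← two_mul,
    ENNReal.ofReal_mul zero_le_two]
  simp

/-- The cumulative hazard `-log P(|Z| > x)` of the absolute value of a standard normal variable. -/
noncomputable def halfNormalHazard (x : ℝ) : ℝ := -Real.log (halfNormalTail x)

theorem measurable_halfNormalHazard : Measurable halfNormalHazard :=
  (Real.measurable_log.comp continuous_halfNormalTail.measurable).neg

theorem halfNormalHazard_zero : halfNormalHazard 0 = 0 := by
  rw [halfNormalHazard, halfNormalTail_zero, Real.log_one, neg_zero]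

theorem halfNormalHazard_eq {x : ℝ} (hx : 0 ≤ x) :
    halfNormalHazard x =
      x ^ 2 / 2 - Real.log (2 * (√(2 * Real.pi))⁻¹) - Real.log (millsIntegral x) := by
  have h1 := millsIntegral_pos hx
  have h2 : 0 < 2 * (√(2 * Real.pi))⁻¹ := by
    have := Real.sqrt_pos.2 (show 0 < 2 * Real.pi by positivity)
    positivity
  rw [halfNormalHazard, halfNormalTail_eq, Real.log_mul (by positivity) h1.ne',
    Real.log_mul h2.ne' (Real.exp_pos _).ne', Real.log_exp]
  ring

theorem halfNormalHazard_sub_ge {w v : ℝ} (hw : 0 ≤ w) (hwv : w ≤ v) :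
    (v ^ 2 - w ^ 2) / 2 ≤ halfNormalHazard v - halfNormalHazard w := by
  rw [halfNormalHazard_eq hw, halfNormalHazard_eq (hw.trans hwv)]
  have := Real.log_le_log (millsIntegral_pos (hw.trans hwv)) (millsIntegral_anti hw hwv)
  linarith

/-- The Mills factor falls by a ratio of at most `v / w`, and `log (v / w) ≤ (v - w) / w` yields the
term `1 / w`. -/
theorem halfNormalHazard_sub_le {w v : ℝ} (hw : 0 < w) (hwv : w ≤ v) :
    halfNormalHazard v - halfNormalHazard w ≤ (v + 1 / w) * (v - w) := by
  have hv := hw.trans_le hwv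
  rw [halfNormalHazard_eq hw.le, halfNormalHazard_eq hv.le]
  have h1 := Real.log_le_log (mul_pos hw (millsIntegral_pos hw.le)) (mul_millsIntegral_mono hw hwv)
  rw [Real.log_mul hw.ne' (millsIntegral_pos hw.le).ne',
    Real.log_mul hv.ne' (millsIntegral_pos hv.le).ne'] at h1
  have h2 := Real.log_le_sub_one_of_pos (div_pos hv hw)
  rw [Real.log_div hv.ne' hw.ne'] at h2
  have h3 : v / w - 1 = 1 / w * (v - w) := by field_simp
  have h4 : (v ^ 2 - w ^ 2) / 2 ≤ v * (v - w) := by nlinarith [sq_nonneg (v - w)]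
  linarith

theorem halfNormalHazard_strictMonoOn : StrictMonoOn halfNormalHazard (Set.Ici 0) := by
  intro w hw v _ hwv
  have h := halfNormalHazard_sub_ge hw hwv.le
  have : 0 ≤ w := hw
  nlinarith

theorem halfNormalHazard_nonneg {x : ℝ} (hx : 0 ≤ x) : 0 ≤ halfNormalHazard x := by
  have := halfNormalHazard_sub_ge le_rfl hx
  rw [halfNormalHazard_zero] at this
  nlinarith

theorem exists_halfNormalHazard_eq {t : ℝ} (ht : 0 ≤ t) : ∃ x, 0 ≤ x ∧ halfNormalHazard x = t := by
  -- The endpoint `t + 2` suffices because the hazard there is at least `(t + 2)² / 2 ≥ t`.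
  have hcont : ContinuousOn halfNormalHazard (Set.Icc 0 (t + 2)) :=
    (continuous_halfNormalTail.continuousOn.log fun x hx => (halfNormalTail_pos hx.1).ne').neg
  have hmem : t ∈ Set.Icc (halfNormalHazard 0) (halfNormalHazard (t + 2)) := by
    rw [halfNormalHazard_zero]
    refine ⟨ht, ?_⟩
    have := halfNormalHazard_sub_ge le_rfl (show 0 ≤ t + 2 by linarith)
    rw [halfNormalHazard_zero] at this
    nlinarith
  obtain ⟨x, hx, hxt⟩ := intermediate_value_Icc (by linarith) hcont hmem
  exact ⟨x, hx.1, hxt⟩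

/-! ### From Gaussian coordinates to exponential variables. -/

theorem measurable_halfNormalHazard_abs_div (σ : ℝ) :
    Measurable fun z : ℝ => halfNormalHazard (|z| / σ) :=
  measurable_halfNormalHazard.comp (by fun_prop)

theorem map_halfNormalHazard_gaussianReal_one :
    (gaussianReal 0 1).map (fun z => halfNormalHazard |z|) = expMeasure 1 := by
  have hm : Measurable fun z : ℝ => halfNormalHazard |z| :=
    measurable_halfNormalHazard.comp (by fun_prop)
  have := isProbabilityMeasure_expMeasure (zero_lt_one (α := ℝ))
  have : IsProbabilityMeasure ((gaussianReal 0 1).map fun z => halfNormalHazard |z|) :=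
    Measure.isProbabilityMeasure_map hm.aemeasurable
  apply Measure.eq_of_cdf
  ext t
  rw [cdf_expMeasure_eq zero_lt_one, cdf_eq_real, map_measureReal_apply hm measurableSet_Iic]
  split_ifs with ht
  · obtain ⟨x, hx, hxt⟩ := exists_halfNormalHazard_eq ht
    have hset : (fun z : ℝ => halfNormalHazard |z|) ⁻¹' Set.Iic t = {z | x < |z|}ᶜ := by
      ext z
      simp only [Set.mem_preimage, Set.mem_Iic, Set.mem_compl_iff, Set.mem_ofPred_eq, not_lt]
      rw [← hxt]
      exact halfNormalHazard_strictMonoOn.le_iff_le (abs_nonneg z) hx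
    rw [hset, probReal_compl_eq_one_sub (measurableSet_lt measurable_const (by fun_prop)),
      measureReal_def, gaussianReal_abs_gt hx, ENNReal.toReal_ofReal (halfNormalTail_pos hx).le,
      ← hxt, halfNormalHazard, one_mul, neg_neg, Real.exp_log (halfNormalTail_pos hx)]
  · have hset : (fun z : ℝ => halfNormalHazard |z|) ⁻¹' Set.Iic t = ∅ := by
      ext z
      simp only [Set.mem_preimage, Set.mem_Iic, Set.mem_empty_iff_false, iff_false, not_le]
      exact (not_le.1 ht).trans_le (halfNormalHazard_nonneg (abs_nonneg z))
    rw [hset, measureReal_empty]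

theorem map_halfNormalHazard_gaussianReal {σ : ℝ} (hσ : 0 < σ) :
    (gaussianReal 0 (Real.toNNReal (σ ^ 2))).map (fun z => halfNormalHazard (|z| / σ)) =
      expMeasure 1 := by
  have h1 : (gaussianReal 0 (Real.toNNReal (σ ^ 2))).map (· / σ) = gaussianReal 0 1 := by
    rw [gaussianReal_map_div_const, zero_div]
    congr 1
    rw [← NNReal.coe_inj]
    simp [max_eq_left (sq_nonneg σ), hσ.ne']
  rw [← map_halfNormalHazard_gaussianReal_one, ← h1, Measure.map_map
    (g := fun z => halfNormalHazard |z|) (measurable_halfNormalHazard.comp (by fun_prop))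
    (by fun_prop)]
  congr 1
  ext z
  simp [abs_div, abs_of_pos hσ]

theorem charFunDual_gaussianReal_zero (v : ℝ≥0) (L : StrongDual ℝ ℝ) :
    charFunDual (gaussianReal 0 v) L = Complex.exp (((-(v * L 1 ^ 2 / 2) : ℝ)) : ℂ) := by
  have : charFunDual (gaussianReal 0 v) L = charFun (gaussianReal 0 v) (L 1) := by
    rw [charFunDual_apply, charFun_apply_real]
    congr 1
    ext x
    have : L x = L 1 * x := by
      conv_lhs => rw [← mul_one x, ← smul_eq_mul, map_smul, smul_eq_mul]
      ring
    rw [this]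
    push_cast
    rfl
  rw [this, charFun_gaussianReal]
  congr 1
  push_cast
  ring

/-- The coordinates of a spherical Gaussian vector in an orthonormal system are independent. -/
theorem map_transpose_mulVec_pi_gaussianReal {n p : ℕ} {X : Matrix (Fin n) (Fin p) ℝ}
    (hX : Xᵀ * X = 1) (v : ℝ≥0) :
    (Measure.pi fun _ : Fin n => gaussianReal 0 v).map (fun y => Xᵀ *ᵥ y) =
      Measure.pi fun _ : Fin p => gaussianReal 0 v := by
  set T : (Fin n → ℝ) →L[ℝ] (Fin p → ℝ) := (Matrix.mulVecLin Xᵀ).toContinuousLinearMap with hT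
  have hTX : (fun y => Xᵀ *ᵥ y) = T := rfl
  have : IsProbabilityMeasure ((Measure.pi fun _ : Fin n => gaussianReal 0 v).map T) :=
    Measure.isProbabilityMeasure_map T.continuous.aemeasurable
  rw [hTX]
  apply Measure.ext_of_charFunDual
  ext L
  rw [charFunDual_map, charFunDual_pi, charFunDual_pi]
  simp only [charFunDual_gaussianReal_zero]
  rw [← Complex.exp_sum, ← Complex.exp_sum, ← Complex.ofReal_sum, ← Complex.ofReal_sum]
  congr 2
  set l : Fin p → ℝ := fun j => L (Pi.single j 1) with hl
  have hLl : ∀ z, L z = z ⬝ᵥ l := by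
    intro z
    conv_lhs => rw [← Finset.univ_sum_single z]
    rw [map_sum, dotProduct]
    refine Finset.sum_congr rfl fun j _ => ?_
    rw [hl, ← smul_eq_mul, ← map_smul, ← Pi.single_smul, smul_eq_mul, mul_one]
  have h1 : ∀ i : Fin n, ((L.comp T).comp (ContinuousLinearMap.single ℝ (fun _ => ℝ) i)) 1 =
      (X *ᵥ l) i := by
    intro i
    change L (Xᵀ *ᵥ Pi.single i 1) = _
    rw [hLl, mulVec_transpose, ← dotProduct_mulVec, single_dotProduct, one_mul]
  have h2 : ∀ j : Fin p, (L.comp (ContinuousLinearMap.single ℝ (fun _ => ℝ) j)) 1 = l j :=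
    fun _ => rfl
  simp only [h1, h2]
  -- A spherical Gaussian characteristic function depends only on the norm of its argument, and `X`
  -- is an isometry.
  have h3 : ∑ i, (X *ᵥ l) i ^ 2 = ∑ j, l j ^ 2 := by
    have : (X *ᵥ l) ⬝ᵥ (X *ᵥ l) = l ⬝ᵥ l := by
      rw [dotProduct_mulVec, vecMul_mulVec, hX, ← mulVec_transpose, transpose_one, one_mulVec]
    simpa [dotProduct, sq] using this
  rw [Finset.sum_neg_distrib, Finset.sum_neg_distrib, ← Finset.sum_div, ← Finset.sum_div,
    ← Finset.mul_sum, ← Finset.mul_sum, h3]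

/-! ### Divergence of the top order statistics, Slutsky's lemma and tightness. -/

/-- The probability that at most `k` of `p` independent variables reach the level `t`. -/
theorem pi_kthLargest_lt_le {p k : ℕ} (hk : k < p) (μ : Measure ℝ) [IsProbabilityMeasure μ]
    (t : ℝ) :
    (Measure.pi fun _ : Fin p => μ).real {x | kthLargest x (k + 1) < t} ≤
      p ^ k * μ.real (Set.Iio t) ^ (p - k) := by
  set ν := Measure.pi fun _ : Fin p => μ with hν
  set A : Finset (Fin p) → Set (Fin p → ℝ) := fun s =>
    Set.univ.pi fun j => if j ∈ s then Set.univ else Set.Iio t with hA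
  have hsub : {x : Fin p → ℝ | kthLargest x (k + 1) < t} ⊆
      ⋃ s ∈ Finset.powersetCard k (Finset.univ : Finset (Fin p)), A s := by
    intro x hx
    obtain ⟨π, hπ⟩ := exists_perm_antitone x
    rw [Set.mem_ofPred_eq, kthLargest_eq_of_antitone hπ ⟨k, hk⟩] at hx
    -- The exceptional set consists of the indices of the `k` largest entries.
    refine Set.mem_biUnion (x := (Finset.Iio (⟨k, hk⟩ : Fin p)).map π.toEmbedding) ?_ ?_
    · simp
    · intro j _
      obtain ⟨m, rfl⟩ := π.surjective j
      simp only [Finset.mem_map_equiv, Equiv.symm_apply_apply, Finset.mem_Iio]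
      split_ifs with h
      · trivial
      · exact lt_of_le_of_lt (hπ (not_lt.1 h)) hx
  have hmeas : ∀ s ∈ Finset.powersetCard k (Finset.univ : Finset (Fin p)),
      ν.real (A s) = μ.real (Set.Iio t) ^ (p - k) := by
    intro s hs
    have hcard := (Finset.mem_powersetCard.1 hs).2
    rw [measureReal_def, hν, hA, Measure.pi_pi, ENNReal.toReal_prod]
    have : ∀ j : Fin p, (μ (if j ∈ s then Set.univ else Set.Iio t)).toReal =
        if j ∈ s then 1 else μ.real (Set.Iio t) := by
      intro j
      split_ifs
      · simp
      · rfl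
    simp only [this]
    rw [Finset.prod_ite, Finset.prod_const_one, one_mul, Finset.prod_const]
    congr 1
    rw [Finset.filter_not, Finset.filter_mem_eq_inter, Finset.univ_inter, ← Finset.compl_eq_univ_sdiff,
      Finset.card_compl, hcard, Fintype.card_fin]
  refine (measureReal_mono hsub (measure_ne_top _ _)).trans ((measureReal_biUnion_finset_le _ _).trans ?_)
  rw [Finset.sum_congr rfl hmeas, Finset.sum_const, Finset.card_powersetCard, Finset.card_univ,
    Fintype.card_fin, nsmul_eq_mul]
  gcongr
  exact_mod_cast Nat.choose_le_pow p k

theorem tendsto_pi_expMeasure_kthLargest_lt (k : ℕ) {t : ℝ} (ht : 0 < t) :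
    Tendsto (fun p : ℕ => (Measure.pi fun _ : Fin p => expMeasure 1).real
      {x | kthLargest x (k + 1) < t}) atTop (𝓝 0) := by
  have := isProbabilityMeasure_expMeasure (zero_lt_one (α := ℝ))
  set q : ℝ := 1 - Real.exp (-t) with hq
  have hq0 : 0 < q := by
    have := Real.exp_lt_exp.2 (neg_lt_zero.2 ht)
    rw [Real.exp_zero] at this
    linarith
  have hq1 : q < 1 := by linarith [Real.exp_pos (-t)]
  have hle : (expMeasure 1).real (Set.Iio t) ≤ q := by
    refine (measureReal_mono Set.Iio_subset_Iic_self).trans (le_of_eq ?_)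
    rw [← cdf_eq_real, cdf_expMeasure_eq zero_lt_one, if_pos ht.le, one_mul]
  have hlim := (tendsto_pow_const_mul_const_pow_of_abs_lt_one k
    (abs_lt.2 ⟨by linarith, hq1⟩)).mul_const (q ^ k)⁻¹
  rw [zero_mul] at hlim
  refine squeeze_zero' (Eventually.of_forall fun p => measureReal_nonneg) ?_ hlim
  filter_upwards [eventually_gt_atTop k] with p hp
  refine (pi_kthLargest_lt_le hp (expMeasure 1) t).trans ?_
  rw [mul_assoc, ← pow_sub₀ q hq0.ne' hp.le]
  gcongr

/-- **Slutsky's lemma** for variables on varying probability spaces: if `D p` eventually has law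
`ν` and `T p - D p` tends to zero in probability, then `T p` converges in law to `ν`. -/
theorem tendstoInDistribution_of_eventually_hasLaw {k : ℕ} {Ω : ℕ → Type*}
    [∀ p, MeasurableSpace (Ω p)] (P : ∀ p, Measure (Ω p)) [∀ p, IsProbabilityMeasure (P p)]
    (ν : Measure (Fin k → ℝ)) [IsProbabilityMeasure ν] {T D : ∀ p, Ω p → Fin k → ℝ}
    (hT : ∀ p, AEMeasurable (T p) (P p)) (hDm : ∀ p, AEMeasurable (D p) (P p))
    (hD : ∀ᶠ p in atTop, (P p).map (D p) = ν)
    (hsub : ∀ ε : ℝ, 0 < ε →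
      Tendsto (fun p => (P p).real {ω | ε ≤ ‖T p ω - D p ω‖}) atTop (𝓝 0)) :
    TendstoInDistribution T atTop (id : (Fin k → ℝ) → (Fin k → ℝ)) P ν := by
  -- Convergence in law involves only the law at each `p`, so all the spaces may be coupled as
  -- coordinates of one product. `T p` and `D p` read the same coordinate, which keeps the law of
  -- their difference.
  set Q := Measure.infinitePi P with hQ
  have hev : ∀ p, MeasurePreserving (fun ω : ∀ p, Ω p => ω p) Q (P p) :=
    fun p => measurePreserving_eval_infinitePi P p
  have hT' : ∀ p, AEMeasurable (fun ω : ∀ p, Ω p => T p (ω p)) Q :=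
    fun p => (hT p).comp_quasiMeasurePreserving (hev p).quasiMeasurePreserving
  have hD' : ∀ p, AEMeasurable (fun ω : ∀ p, Ω p => D p (ω p)) Q :=
    fun p => (hDm p).comp_quasiMeasurePreserving (hev p).quasiMeasurePreserving
  have hmapT : ∀ p, Q.map (fun ω : ∀ p, Ω p => T p (ω p)) = (P p).map (T p) := by
    intro p
    have h := AEMeasurable.map_map_of_aemeasurable (g := T p) (f := fun ω : ∀ p, Ω p => ω p)
      (μ := Q) (by rw [(hev p).map_eq]; exact hT p) (hev p).measurable.aemeasurable
    rw [(hev p).map_eq] at h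
    exact h.symm
  have hmapD : ∀ p, Q.map (fun ω : ∀ p, Ω p => D p (ω p)) = (P p).map (D p) := by
    intro p
    have h := AEMeasurable.map_map_of_aemeasurable (g := D p) (f := fun ω : ∀ p, Ω p => ω p)
      (μ := Q) (by rw [(hev p).map_eq]; exact hDm p) (hev p).measurable.aemeasurable
    rw [(hev p).map_eq] at h
    exact h.symm
  have hDlim : TendstoInDistribution (fun p (ω : ∀ p, Ω p) => D p (ω p)) atTop
      (id : (Fin k → ℝ) → (Fin k → ℝ)) (fun _ => Q) ν := by
    refine ⟨hD', aemeasurable_id, ?_⟩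
    refine tendsto_const_nhds.congr' ?_
    filter_upwards [hD] with p hp
    apply Subtype.ext
    simp only [Measure.map_id]
    rw [hmapD p, hp]
  have hmeas : TendstoInMeasure Q ((fun p (ω : ∀ p, Ω p) => T p (ω p)) -
      fun p (ω : ∀ p, Ω p) => D p (ω p)) atTop 0 := by
    rw [tendstoInMeasure_iff_measureReal_norm]
    intro ε hε
    refine (hsub ε hε).congr fun p => ?_
    have hnull : NullMeasurableSet {ω | ε ≤ ‖T p ω - D p ω‖} (P p) :=
      nullMeasurableSet_le aemeasurable_const ((hT p).sub (hDm p)).norm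
    rw [measureReal_def, ← (hev p).measure_preimage hnull, measureReal_def]
    simp
  have hlim := tendstoInDistribution_of_tendstoInMeasure_sub _ _ hDlim hmeas hT'
  refine ⟨hT, aemeasurable_id, ?_⟩
  refine hlim.tendsto.congr fun p => ?_
  apply Subtype.ext
  exact hmapT p

theorem exists_measureReal_norm_gt_lt {k : ℕ} (ν : Measure (Fin k → ℝ)) [IsProbabilityMeasure ν]
    {δ : ℝ} (hδ : 0 < δ) : ∃ K : ℝ, 0 < K ∧ ν.real {x | K < ‖x‖} < δ := by
  obtain ⟨C, hC, hle⟩ := isTightMeasureSet_iff_exists_isCompact_measure_compl_le.1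
    (isTightMeasureSet_singleton (μ := ν)) (ENNReal.ofReal (δ / 2))
    (ENNReal.ofReal_pos.2 (half_pos hδ))
  obtain ⟨K, hK⟩ := hC.isBounded.subset_closedBall 0
  refine ⟨max K 1, by positivity, ?_⟩
  have hsub : {x : Fin k → ℝ | max K 1 < ‖x‖} ⊆ Cᶜ := by
    intro x hx hxC
    have := hK hxC
    rw [mem_closedBall_zero_iff] at this
    exact absurd (lt_of_le_of_lt (le_max_left K 1) hx) (not_lt.2 this)
  have h1 : ν.real {x | max K 1 < ‖x‖} ≤ δ / 2 := by
    rw [measureReal_def]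
    refine ENNReal.toReal_le_of_le_ofReal (half_pos hδ).le ?_
    exact (measure_mono hsub).trans (hle ν rfl)
  linarith

/-! ### Comparison of the statistics with the exponential gaps. -/

/-- With `d` the hazard gap, `v (v - w)` exceeds `d` by at most `(v - w)² / 2` and falls short of it
by at most `(v - w) / w`; moreover `v - w ≤ d / w`. -/
theorem abs_scadFormula_sub_le {a σ w v : ℝ} (hσ : 0 < σ) (hw : 0 < w) (hwv : w ≤ v)
    (hd : halfNormalHazard v - halfNormalHazard w ≤ w ^ 2) :
    |scadFormula a σ (σ * v) (σ * w) - (halfNormalHazard v - halfNormalHazard w)| ≤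
      (halfNormalHazard v - halfNormalHazard w) *
        (halfNormalHazard v - halfNormalHazard w + 1) / w ^ 2 := by
  have h1 := halfNormalHazard_sub_ge hw.le hwv
  have h2 := halfNormalHazard_sub_le hw hwv
  set d := halfNormalHazard v - halfNormalHazard w with hddef
  have h3 : w * (v - w) ≤ d := by nlinarith [sq_nonneg (v - w)]
  have hd0 : 0 ≤ d := (mul_nonneg hw.le (sub_nonneg.2 hwv)).trans h3
  have h4 : v - w ≤ d / w := by rw [le_div_iff₀ hw]; linarith
  -- If `v > 2 w`, the gap would be at least `(v² - w²) / 2 > 3 w² / 2`, against `hd`. So the first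
  -- case of the formula applies.
  have h5 : v ≤ 2 * w := by
    by_contra hlt
    nlinarith
  have hform : scadFormula a σ (σ * v) (σ * w) = v * (v - w) := by
    rw [scadFormula, if_pos (by nlinarith)]
    field_simp
  have hsq : (v - w) ^ 2 ≤ d ^ 2 / w ^ 2 := by
    rw [← div_pow]
    exact pow_le_pow_left₀ (by linarith) h4 2
  have hlin : 1 / w * (v - w) ≤ d / w ^ 2 := by
    calc 1 / w * (v - w) ≤ 1 / w * (d / w) := by gcongr
      _ = d / w ^ 2 := by field_simp
  have hsplit : d * (d + 1) / w ^ 2 = d ^ 2 / w ^ 2 + d / w ^ 2 := by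
    rw [← add_div]; ring
  have hp1 : 0 ≤ d ^ 2 / w ^ 2 := by positivity
  have hp2 : 0 ≤ d / w ^ 2 := by positivity
  rw [hform, abs_le, hsplit]
  constructor
  · nlinarith
  · nlinarith

theorem measurable_scadFormula (a σ : ℝ) :
    Measurable fun q : ℝ × ℝ => scadFormula a σ q.1 q.2 := by
  unfold scadFormula
  refine Measurable.ite (measurableSet_le (by fun_prop) (by fun_prop)) (by fun_prop) ?_
  exact Measurable.ite (measurableSet_lt (by fun_prop) (by fun_prop)) (by fun_prop) (by fun_prop)

section NullModel

variable {n p : ℕ} {X : Matrix (Fin n) (Fin p) ℝ} {σ : ℝ} {Ω : Type*} [MeasurableSpace Ω]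
  {P : Measure Ω} {y : Ω → Fin n → ℝ}

theorem hasLaw_transpose_mulVec (hX : Xᵀ * X = 1) (hy : GaussianLinearModel X 0 σ y P) :
    HasLaw (fun ω => Xᵀ *ᵥ y ω)
      (Measure.pi fun _ : Fin p => gaussianReal 0 (Real.toNNReal (σ ^ 2))) P := by
  have hy' : HasLaw y (Measure.pi fun _ : Fin n => gaussianReal 0 (Real.toNNReal (σ ^ 2))) P := by
    simpa [GaussianLinearModel] using hy
  have h : HasLaw (fun z : Fin n → ℝ => Xᵀ *ᵥ z)
      (Measure.pi fun _ : Fin p => gaussianReal 0 (Real.toNNReal (σ ^ 2)))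
      (Measure.pi fun _ : Fin n => gaussianReal 0 (Real.toNNReal (σ ^ 2))) :=
    ⟨(by fun_prop : Measurable fun z : Fin n → ℝ => Xᵀ *ᵥ z).aemeasurable,
      map_transpose_mulVec_pi_gaussianReal hX _⟩
  exact h.fun_comp hy'

/-- The absolute correlations of the variables with the response, transformed to standard
exponential variables. -/
noncomputable def expScores (X : Matrix (Fin n) (Fin p) ℝ) (σ : ℝ) (y : Fin n → ℝ) (j : Fin p) :
    ℝ :=
  halfNormalHazard (|(Xᵀ *ᵥ y) j| / σ)

theorem hasLaw_expScores (hσ : 0 < σ) (hX : Xᵀ * X = 1) (hy : GaussianLinearModel X 0 σ y P) :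
    HasLaw (fun ω => expScores X σ (y ω)) (Measure.pi fun _ : Fin p => expMeasure 1) P := by
  have hm := measurable_halfNormalHazard_abs_div σ
  have hmap := map_halfNormalHazard_gaussianReal hσ
  have h : HasLaw (fun (z : Fin p → ℝ) j => halfNormalHazard (|z j| / σ))
      (Measure.pi fun _ : Fin p => expMeasure 1)
      (Measure.pi fun _ : Fin p => gaussianReal 0 (Real.toNNReal (σ ^ 2))) := by
    refine ⟨(measurable_pi_lambda _ fun j => hm.comp (measurable_pi_apply j)).aemeasurable, ?_⟩
    have := isProbabilityMeasure_expMeasure (zero_lt_one (α := ℝ))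
    have : ∀ _ : Fin p, SigmaFinite ((gaussianReal 0 (Real.toNNReal (σ ^ 2))).map
        fun z => halfNormalHazard (|z| / σ)) := by
      rw [hmap]; infer_instance
    rw [Measure.pi_map_pi fun _ => hm.aemeasurable, hmap]
  exact h.fun_comp (hasLaw_transpose_mulVec hX hy)

theorem ae_ne_zero_pi_expMeasure (p : ℕ) :
    ∀ᵐ x ∂(Measure.pi fun _ : Fin p => expMeasure 1), ∀ j, x j ≠ 0 := by
  rw [pi_expMeasure_eq]
  refine (withDensity_absolutelyContinuous _ _).ae_le ?_
  exact ae_all_iff.2 fun j => Measure.ae_eval_ne (fun _ => volume) j 0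

/-- Pulled back from the exponential scores: equal absolute correlations have equal scores, and a
zero correlation has score `0`. -/
theorem ae_abs_injective_and_ne_zero (hσ : 0 < σ) (hX : Xᵀ * X = 1)
    (hy : GaussianLinearModel X 0 σ y P) :
    ∀ᵐ ω ∂P, Function.Injective (fun j => |(Xᵀ *ᵥ y ω) j|) ∧ ∀ j, (Xᵀ *ᵥ y ω) j ≠ 0 := by
  have hlaw := hasLaw_expScores hσ hX hy
  have h1 : ∀ᵐ ω ∂P, Function.Injective (expScores X σ (y ω)) :=
    ae_of_ae_map hlaw.aemeasurable (by rw [hlaw.map_eq]; exact ae_injective_pi_expMeasure p)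
  have h2 : ∀ᵐ ω ∂P, ∀ j, expScores X σ (y ω) j ≠ 0 :=
    ae_of_ae_map (p := fun x : Fin p → ℝ => ∀ j, x j ≠ 0) hlaw.aemeasurable
      (by rw [hlaw.map_eq]; exact ae_ne_zero_pi_expMeasure p)
  filter_upwards [h1, h2] with ω hω1 hω2
  refine ⟨fun i j hij => hω1 ?_, fun j hj => hω2 j ?_⟩
  · simp only at hij
    rw [expScores, expScores, hij]
  · rw [expScores, hj, abs_zero, zero_div, halfNormalHazard_zero]

theorem ae_covStat_scad_eq {a : ℝ} (ha : 2 < a) (hσ : 0 < σ) (hX : Xᵀ * X = 1)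
    (hy : GaussianLinearModel X 0 σ y P) :
    ∀ᵐ ω ∂P, ∀ k, covStat (scadPenalty a) σ X (y ω) (k + 1) =
      scadFormula a σ (absCorrOrderStat X (y ω) (k + 1)) (absCorrOrderStat X (y ω) (k + 2)) := by
  filter_upwards [ae_abs_injective_and_ne_zero hσ hX hy] with ω hω k
  exact covStat_scad_eq ha σ hX (y ω) hω.1 hω.2 k

/-- The estimates are defined by a choice of minimizer, so measurability comes from the almost sure
closed form. -/
theorem aemeasurable_covStat_scad {a : ℝ} (ha : 2 < a) (hσ : 0 < σ) (hX : Xᵀ * X = 1)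
    (hy : GaussianLinearModel X 0 σ y P) (k : ℕ) :
    AEMeasurable (fun ω (i : Fin k) => covStat (scadPenalty a) σ X (y ω) ((i : ℕ) + 1)) P := by
  refine aemeasurable_pi_lambda _ fun i => ?_
  have hm : ∀ m, Measurable fun z : Fin p → ℝ => kthLargest (fun j => |z j|) (m + 1) := fun m =>
    (measurable_kthLargest p m).comp
      (measurable_pi_lambda _ fun j => (measurable_pi_apply j).abs)
  have h := ((measurable_scadFormula a σ).comp ((hm i).prodMk (hm (i + 1)))).comp_aemeasurable
    (hasLaw_transpose_mulVec hX hy).aemeasurable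
  refine h.congr ?_
  filter_upwards [ae_covStat_scad_eq ha hσ hX hy] with ω hω
  exact (hω i).symm

theorem kthLargest_expScores (hσ : 0 < σ) (y : Fin n → ℝ) (k : ℕ) :
    kthLargest (expScores X σ y) (k + 1) =
      halfNormalHazard (absCorrOrderStat X y (k + 1) / σ) := by
  refine kthLargest_comp (f := fun t => halfNormalHazard (t / σ)) (fun _ => abs_nonneg _) ?_ ?_ k
  · intro s hs t ht hst
    exact halfNormalHazard_strictMonoOn.monotoneOn (div_nonneg hs hσ.le) (div_nonneg ht hσ.le)
      (div_le_div_of_nonneg_right hst hσ.le)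
  · simp only [zero_div, halfNormalHazard_zero]

theorem expScores_nonneg (hσ : 0 < σ) (y : Fin n → ℝ) (j : Fin p) : 0 ≤ expScores X σ y j :=
  halfNormalHazard_nonneg (div_nonneg (abs_nonneg _) hσ.le)

theorem kthLargest_antitone {v : Fin p → ℝ} (hv : ∀ j, 0 ≤ v j) :
    Antitone fun k => kthLargest v (k + 1) :=
  antitone_nat_of_succ_le fun k => kthLargest_succ_le hv k

/-- The gaps between the largest order statistics of the exponential scores. -/
noncomputable def expGaps (k : ℕ) (X : Matrix (Fin n) (Fin p) ℝ) (σ : ℝ) (y : Fin n → ℝ)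
    (i : Fin k) : ℝ :=
  kthLargest (expScores X σ y) (i + 1) - kthLargest (expScores X σ y) (i + 2)

theorem measurable_first_spacings (k p : ℕ) : Measurable fun (x : Fin p → ℝ) (i : Fin k) =>
    kthLargest x (i + 1) - kthLargest x (i + 2) :=
  measurable_pi_lambda _ fun i => (measurable_kthLargest p i).sub (measurable_kthLargest p (i + 1))

theorem aemeasurable_expGaps (hσ : 0 < σ) (hX : Xᵀ * X = 1) (hy : GaussianLinearModel X 0 σ y P)
    (k : ℕ) : AEMeasurable (fun ω => expGaps k X σ (y ω)) P :=
  (measurable_first_spacings k p).comp_aemeasurable (hasLaw_expScores hσ hX hy).aemeasurable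

theorem map_expGaps (hσ : 0 < σ) (hX : Xᵀ * X = 1) (hy : GaussianLinearModel X 0 σ y P) {k : ℕ}
    (hk : k ≤ p) : P.map (fun ω => expGaps k X σ (y ω)) = expLimitLaw k := by
  have hlaw := hasLaw_expScores hσ hX hy
  rw [← map_first_spacings_pi_expMeasure hk, ← hlaw.map_eq,
    AEMeasurable.map_map_of_aemeasurable (measurable_first_spacings k p).aemeasurable
      hlaw.aemeasurable]
  rfl

theorem norm_scadFormula_sub_expGaps_le {a : ℝ} (hσ : 0 < σ) (y : Fin n → ℝ) {k : ℕ} {K M : ℝ}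
    (hM : 0 < M) (hK : 0 ≤ K) (hKM : K ≤ M ^ 2) (hgap : ‖expGaps k X σ y‖ ≤ K)
    (hlow : halfNormalHazard M ≤ kthLargest (expScores X σ y) (k + 1)) :
    ‖(fun i : Fin k => scadFormula a σ (absCorrOrderStat X y (i + 1))
        (absCorrOrderStat X y (i + 2))) - expGaps k X σ y‖ ≤ K * (K + 1) / M ^ 2 := by
  refine (pi_norm_le_iff_of_nonneg (by positivity)).2 fun i => ?_
  set v := absCorrOrderStat X y (i + 1) / σ with hv
  set w := absCorrOrderStat X y (i + 2) / σ with hw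
  have hv0 : σ * v = absCorrOrderStat X y (i + 1) := by rw [hv]; field_simp
  have hw0 : σ * w = absCorrOrderStat X y (i + 2) := by rw [hw]; field_simp
  have hwnn : 0 ≤ w := div_nonneg (absCorrOrderStat_nonneg X y (i + 1)) hσ.le
  have hwv : w ≤ v := div_le_div_of_nonneg_right
    (kthLargest_succ_le (fun _ => abs_nonneg _) i) hσ.le
  have hMw : M ≤ w := by
    rw [← halfNormalHazard_strictMonoOn.le_iff_le hM.le hwnn]
    refine hlow.trans ?_
    rw [hw, ← kthLargest_expScores hσ y (i + 1)]
    -- One lower bound, on the `(k + 1)`-st score, controls every `w` that occurs, as these come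
    -- from indices `2, ..., k + 1`.
    exact kthLargest_antitone (expScores_nonneg hσ y) (show (i : ℕ) + 1 ≤ k from i.2)
  have hgapi : expGaps k X σ y i = halfNormalHazard v - halfNormalHazard w := by
    rw [expGaps, kthLargest_expScores hσ y i, kthLargest_expScores hσ y (i + 1)]
  have hd : halfNormalHazard v - halfNormalHazard w ≤ K := by
    rw [← hgapi]
    exact (le_abs_self _).trans ((norm_le_pi_norm (expGaps k X σ y) i).trans hgap)
  have hd0 : 0 ≤ halfNormalHazard v - halfNormalHazard w :=
    sub_nonneg.2 (halfNormalHazard_strictMonoOn.monotoneOn hwnn (hwnn.trans hwv) hwv)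
  have hMw2 : M ^ 2 ≤ w ^ 2 := pow_le_pow_left₀ hM.le hMw 2
  rw [Pi.sub_apply, ← hv0, ← hw0, hgapi, Real.norm_eq_abs]
  refine (abs_scadFormula_sub_le hσ (hM.trans_le hMw) hwv (by linarith)).trans ?_
  gcongr

end NullModel

theorem tendsto_covStat_scad_sub_expGaps {a : ℝ} (ha : 2 < a) {σ : ℝ} (hσ : 0 < σ)
    {Ω : ℕ → Type*} [∀ p, MeasurableSpace (Ω p)] (P : ∀ p, Measure (Ω p))
    [∀ p, IsProbabilityMeasure (P p)] {n : ℕ → ℕ} {X : ∀ p, Matrix (Fin (n p)) (Fin p) ℝ}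
    (hX : ∀ p, (X p)ᵀ * X p = 1) {y : ∀ p, Ω p → Fin (n p) → ℝ}
    (hy : ∀ p, GaussianLinearModel (X p) 0 σ (y p) (P p)) (k : ℕ) {ε : ℝ} (hε : 0 < ε) :
    Tendsto (fun p => (P p).real {ω | ε ≤ ‖(fun i : Fin k =>
      covStat (scadPenalty a) σ (X p) (y p ω) ((i : ℕ) + 1)) - expGaps k (X p) σ (y p ω)‖})
      atTop (𝓝 0) := by
  rw [Metric.tendsto_nhds]
  intro δ hδ
  -- For `p ≥ k` the gaps have exactly the limit law, so a single `K` works for all these `p`; `M`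
  -- is then chosen to push the error bound below `ε`.
  obtain ⟨K, hK0, hK⟩ := exists_measureReal_norm_gt_lt (expLimitLaw k) (half_pos hδ)
  obtain ⟨M, hM, hKM, hKε⟩ : ∃ M : ℝ, 0 < M ∧ K ≤ M ^ 2 ∧ K * (K + 1) / M ^ 2 < ε := by
    have hsq : Tendsto (fun M : ℝ => M ^ 2) atTop atTop := tendsto_pow_atTop two_ne_zero
    have hlim : Tendsto (fun M : ℝ => K * (K + 1) / M ^ 2) atTop (𝓝 0) :=
      tendsto_const_nhds.div_atTop hsq
    exact ((eventually_gt_atTop 0).and ((hsq.eventually_ge_atTop K).and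
      (hlim.eventually_lt_const hε))).exists
  have hHM : 0 < halfNormalHazard M := by
    have := halfNormalHazard_strictMonoOn Set.self_mem_Ici hM.le hM
    rwa [halfNormalHazard_zero] at this
  filter_upwards [(tendsto_pi_expMeasure_kthLargest_lt k hHM).eventually_lt_const (half_pos hδ),
    eventually_ge_atTop k] with p hp hkp
  rw [Real.dist_eq, sub_zero, abs_of_nonneg measureReal_nonneg]
  have hlaw := hasLaw_expScores hσ (hX p) (hy p)
  have hA : (P p).real {ω | kthLargest (expScores (X p) σ (y p ω)) (k + 1) < halfNormalHazard M} <
      δ / 2 := by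
    rw [hlaw.measureReal_eq (p := fun x => kthLargest x (k + 1) < halfNormalHazard M)
      (measurableSet_lt (measurable_kthLargest p k) measurable_const)]
    exact hp
  have hgaplaw : HasLaw (fun ω => expGaps k (X p) σ (y p ω)) (expLimitLaw k) (P p) :=
    ⟨aemeasurable_expGaps hσ (hX p) (hy p) k, map_expGaps hσ (hX p) (hy p) hkp⟩
  have hB : (P p).real {ω | K < ‖expGaps k (X p) σ (y p ω)‖} < δ / 2 := by
    rw [hgaplaw.measureReal_eq (p := fun x => K < ‖x‖)
      (measurableSet_lt measurable_const measurable_norm)]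
    exact hK
  have hle : (P p).real {ω | ε ≤ ‖(fun i : Fin k =>
      covStat (scadPenalty a) σ (X p) (y p ω) ((i : ℕ) + 1)) - expGaps k (X p) σ (y p ω)‖} ≤
      (P p).real ({ω | kthLargest (expScores (X p) σ (y p ω)) (k + 1) < halfNormalHazard M} ∪
        {ω | K < ‖expGaps k (X p) σ (y p ω)‖}) := by
    refine ENNReal.toReal_mono (measure_ne_top _ _) (measure_mono_ae ?_)
    filter_upwards [ae_covStat_scad_eq ha hσ (hX p) (hy p)] with ω hω (hmem : ε ≤ _)
    by_contra hnot
    have hnot' : ¬ (kthLargest (expScores (X p) σ (y p ω)) (k + 1) < halfNormalHazard M ∨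
      K < ‖expGaps k (X p) σ (y p ω)‖) := hnot
    push Not at hnot'
    have hbound := norm_scadFormula_sub_expGaps_le (a := a) hσ (y p ω) hM hK0.le hKM hnot'.2
      hnot'.1
    simp only [hω] at hmem
    linarith
  have := measureReal_union_le (μ := P p)
    {ω | kthLargest (expScores (X p) σ (y p ω)) (k + 1) < halfNormalHazard M}
    {ω | K < ‖expGaps k (X p) σ (y p ω)‖}
  linarith

theorem mainTheorem1
    (a : ℝ) (ha : 2 < a) (σ : ℝ) (hσ : 0 < σ)
    {Ω : ℕ → Type*} [∀ p, MeasurableSpace (Ω p)]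
    (P : ∀ p, Measure (Ω p)) [∀ p, IsProbabilityMeasure (P p)]
    (n : ℕ → ℕ) (X : ∀ p, Matrix (Fin (n p)) (Fin p) ℝ)
    (hX : ∀ p, (X p)ᵀ * X p = 1)
    (y : ∀ p, Ω p → Fin (n p) → ℝ)
    (hy : ∀ p, GaussianLinearModel (X p) 0 σ (y p) (P p)) :
    (∀ p k : ℕ, 1 ≤ k → k < p → ∀ᵐ ω ∂(P p),
      covStat (scadPenalty a) σ (X p) (y p ω) k =
        scadFormula a σ (absCorrOrderStat (X p) (y p ω) k)
          (absCorrOrderStat (X p) (y p ω) (k + 1))) ∧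
    ∀ k : ℕ, 1 ≤ k →
      TendstoInDistribution
        (fun (p : ℕ) (ω : Ω p) (i : Fin k) =>
          covStat (scadPenalty a) σ (X p) (y p ω) ((i : ℕ) + 1))
        atTop
        (id : (Fin k → ℝ) → (Fin k → ℝ))
        P
        (expLimitLaw k) := by
  refine ⟨fun p k hk _ => ?_, fun k _ => ?_⟩
  · obtain ⟨m, rfl⟩ := Nat.exists_eq_add_of_le' hk
    filter_upwards [ae_covStat_scad_eq ha hσ (hX p) (hy p)] with ω hω
    exact hω m
  · refine tendstoInDistribution_of_eventually_hasLaw P (expLimitLaw k)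
      (D := fun p ω => expGaps k (X p) σ (y p ω))
      (fun p => aemeasurable_covStat_scad ha hσ (hX p) (hy p) k)
      (fun p => aemeasurable_expGaps hσ (hX p) (hy p) k) ?_
      fun ε hε => tendsto_covStat_scad_sub_expGaps ha hσ P hX hy k hε
    filter_upwards [eventually_ge_atTop k] with p hp
    exact map_expGaps hσ (hX p) (hy p) hp
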